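/- **Setting.** Let $N,d\ge 1$. Write $|\cdot|$ for the max-norm on $(\mathbb R^d)^N$ and on $\mathbb R^d$. For $u\in(\mathbb Z^d)^N$ and an integer $L\ge 1$ let $\Lambda_L(u)=\{x:|x-u|<L+\tfrac12\}$ (the cube of radius $L$), $\Lambda^{\rm out}_L(u)=\{x: L-\tfrac12<|x-u|<L+\tfrac12\}$ (its boundary belt), and let $\chi_u$ be the indicator function of the unit cell $\{x:|x-u|\le\tfrac12\}$. Let $H=-\tfrac12\Delta+W$ with $W(x)=\sum_{1\le i<j\le N}U(|x_i-x_j|)+\sum_{i=1}^N V(x_i)$, where: * $U$ is measurable and $0\le U(r)\le C_U e^{-r^\zeta}$ for $r\ge 0$, with some $\zeta,C_U>0$; * $V(x)=\sum_{a\in\mathbb Z^d}v_a\,\varphi_a(x-a)$, where the bump functions $\varphi_a\ge 0$ are measurable, have supports of diameter at most $r_1<\infty$, and satisfy $\sum_a\varphi_a(x-a)=C_\varphi$ for a.e. $x$, with a constant $C_\varphi\in(0,\infty)$ (flat tiling); * $v=(v_a)_{a\in\mathbb Z^d}$ is any realization of the amplitudes, i.e. any configuration with values in $[0,c_V]$,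 where $c_V>0$. For a cube $\Lambda$ let $H_\Lambda$ be the realization of $H$ in $L^2(\Lambda)$ with Dirichlet boundary conditions, $\Sigma(H_\Lambda)$ its spectrum, and $G_\Lambda(E)=(H_\Lambda-E)^{-1}$ for $E\notin\Sigma(H_\Lambda)$. **Parameters.** Let $\tau>\max(\zeta^{-1},1)$, $\alpha\in\mathbb N$ with $\alpha>2\tau$, $0<\beta<\min\big(\tfrac14,\zeta,\tfrac7{8\alpha}\big)$, $K\in\mathbb N$ with $K+1>4\alpha$, and fix a constant $C_{\rm geom}>0$. Given an integer $L_0\ge 1$, put $L_k=L_0^{\alpha^k}$ for $k\ge 0$. **Definitions.** Let $E\in\mathbb R$ and $m>0$. * $\Lambda_L(u)$ is *$(E,m)$-nonsingular* if $E\notin\Sigma(H_{\Lambda_L(u)})$ and $C_{\rm geom}(3L)^{Nd}\,\big\|\mathbf 1_{\Lambda_L^{\rm out}(u)}\,G_{\Lambda_L(u)}(E)\,\chi_u\big\|\le e^{-mL}$; otherwise it is *$(E,m)$-singular*. * $\Lambda_L(u)$ is *$(E,\beta)$-nonresonant* if $\operatorname{dist}(\Sigma(H_{\Lambda_L(u)}),E)\ge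 e^{-L^\beta}$. * $\Lambda_L(u)$ is *weakly interactive* if $|u_i-u_j|\ge 3NL^\tau$ for some $i\ne j$, and *strongly interactive* otherwise. * $\Lambda_{L_{k+1}}(u)$ is *$(E,m)$-bad* if it contains a weakly interactive $(E,m)$-singular cube of radius $L_k$ with center in $(\mathbb Z^d)^N$, or at least $K+1$ strongly interactive $(E,m)$-singular cubes of radius $L_k$ with centers in $(\mathbb Z^d)^N$ whose pairwise distances are at least $9NL_k^\tau$; otherwise it is *$(E,m)$-good*. **Lemma.** For all $E_{\max},M\in\mathbb R$ there is an integer $L_{\min}$, depending only on $E_{\max}$, $M$, $N$, $d$, the functions $U,\varphi_a$, and the constants and parameters above, such that for every integer $L_0\ge L_{\min}$, every $m$ with $L_0^{-1/2}\le m\le M$, every amplitude configuration $v\in[0,c_V]^{\mathbb Z^d}$, every $E\le E_{\max}$, every $k\ge 0$ and every $u\in(\mathbb Z^d)^N$: if the cube $\Lambda_{L_{k+1}}(u)$ is $(E,m)$-good and $(E,\beta)$-nonresonant, then it is $(E,m)$-nonsingular. -/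

import Mathlib

open MeasureTheory Filter Topology
open scoped ContDiff

noncomputable section

namespace MultiParticle

/-- The configuration space `(ℝ^d)^N`; its norm is the max-norm and `volume` is Lebesgue measure. -/
abbrev Config (N d : ℕ) : Type := Fin N → Fin d → ℝ

/-- The lattice `(ℤ^d)^N`. -/
abbrev Lattice (N d : ℕ) : Type := Fin N → Fin d → ℤ

variable {N d : ℕ}

/-- A lattice point seen as a point of the configuration space. -/
def Lattice.toConfig (u : Lattice N d) : Config N d := fun i j => (u i j : ℝ)

/-- The open cube of radius `L` (edge length `2L+1`) centred at `u`. -/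
def cube (u : Lattice N d) (L : ℕ) : Set (Config N d) :=
  {x | ‖x - u.toConfig‖ < (L : ℝ) + 1 / 2}

/-- The closed unit cell centred at `u`. -/
def cell (u : Lattice N d) : Set (Config N d) :=
  {x | ‖x - u.toConfig‖ ≤ 1 / 2}

/-- The boundary belt of the cube of radius `L` centred at `u`. -/
def belt (u : Lattice N d) (L : ℕ) : Set (Config N d) :=
  {x | (L : ℝ) - 1 / 2 < ‖x - u.toConfig‖ ∧ ‖x - u.toConfig‖ < (L : ℝ) + 1 / 2}

/-! ### The potential energy -/

/-- A two-body potential on `[0, ∞)` with `0 ≤ U(r) ≤ C_U exp (-r^ζ)`. -/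
structure IsInteraction (U : ℝ → ℝ) (ζ C_U : ℝ) : Prop where
  measurable : Measurable U
  zeta_pos : 0 < ζ
  const_pos : 0 < C_U
  nonneg : ∀ r, 0 ≤ r → 0 ≤ U r
  le : ∀ r, 0 ≤ r → U r ≤ C_U * Real.exp (-(r ^ ζ))

/-- Nonnegative bump functions of uniformly bounded support diameter whose lattice translates
add up to a positive constant almost everywhere. -/
structure IsFlatTiling (φ : (Fin d → ℤ) → (Fin d → ℝ) → ℝ) (r₁ C_φ : ℝ) : Prop where
  measurable : ∀ a, Measurable (φ a)
  nonneg : ∀ a x, 0 ≤ φ a x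
  const_pos : 0 < C_φ
  diam_support : ∀ a x y, φ a x ≠ 0 → φ a y ≠ 0 → dist x y ≤ r₁
  tiling : ∀ᵐ x : Fin d → ℝ, HasSum (fun a : Fin d → ℤ => φ a (x - fun j => (a j : ℝ))) C_φ

/-- The one-particle alloy potential `V(x) = ∑_a v_a φ_a(x - a)` with amplitudes `v`. -/
def alloy (φ : (Fin d → ℤ) → (Fin d → ℝ) → ℝ) (v : (Fin d → ℤ) → ℝ) (x : Fin d → ℝ) : ℝ :=
  ∑' a : Fin d → ℤ, v a * φ a (x - fun j => (a j : ℝ))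

/-- The potential energy `∑_{i<j} U(|x_i - x_j|) + ∑_i V(x_i)`. -/
def potential (U : ℝ → ℝ) (φ : (Fin d → ℤ) → (Fin d → ℝ) → ℝ) (v : (Fin d → ℤ) → ℝ)
    (x : Config N d) : ℝ :=
  (∑ i : Fin N, ∑ j ∈ Finset.univ.filter (fun j => i < j), U ‖x i - x j‖)
    + ∑ i : Fin N, alloy φ v (x i)

/-! ### The Dirichlet Hamiltonian `-Δ/2 + W` in a set `Λ` and its resolvent -/

/-- The Hilbert space `L²(Λ)`. -/
abbrev L2 (Λ : Set (Config N d)) : Type := Lp ℂ 2 (volume.restrict Λ)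

/-- `C_c^∞(Λ)`. -/
def IsTest (Λ : Set (Config N d)) (η : Config N d → ℂ) : Prop :=
  ContDiff ℝ ∞ η ∧ HasCompactSupport η ∧ tsupport η ⊆ Λ

/-- The partial derivative in the `j`-th coordinate of the `i`-th particle. -/
def pderiv (i : Fin N) (j : Fin d) (η : Config N d → ℂ) (x : Config N d) : ℂ :=
  fderiv ℝ η x (Pi.single i (Pi.single j 1))

/-- `f` lies in `H¹₀(Λ)`, the `H¹`-closure of `C_c^∞(Λ)`, and has gradient `g`. -/
def HasH10Gradient (Λ : Set (Config N d)) (f : L2 Λ) (g : Fin N → Fin d → L2 Λ) : Prop :=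
  ∃ η : ℕ → Config N d → ℂ, (∀ n, IsTest Λ (η n)) ∧
    Tendsto (fun n => eLpNorm (fun x => η n x - f x) 2 (volume.restrict Λ)) atTop (𝓝 0) ∧
    ∀ i j, Tendsto (fun n => eLpNorm (fun x => pderiv i j (η n) x - g i j x) 2
      (volume.restrict Λ)) atTop (𝓝 0)

/-- The graph of the operator `H = -Δ/2 + W` in `L²(Λ)` with Dirichlet boundary conditions:
`f` belongs to the domain of `H`, and `H f = h`. -/
def HamiltonianGraph (W : Config N d → ℝ) (Λ : Set (Config N d)) (f h : L2 Λ) : Prop :=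
  ∃ g : Fin N → Fin d → L2 Λ, HasH10Gradient Λ f g ∧
    ∀ η : Config N d → ℂ, IsTest Λ η →
      (1 / 2 : ℂ) * (∑ i, ∑ j, ∫ x in Λ, g i j x * pderiv i j η x)
        + ∫ x in Λ, (W x : ℂ) * f x * η x = ∫ x in Λ, h x * η x

/-- `G = (H - z)⁻¹`, a bounded two-sided inverse. -/
def IsResolvent (W : Config N d → ℝ) (Λ : Set (Config N d)) (z : ℂ)
    (G : L2 Λ →L[ℂ] L2 Λ) : Prop :=
  (∀ h : L2 Λ, HamiltonianGraph W Λ (G h) (h + z • G h)) ∧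
    ∀ f h : L2 Λ, HamiltonianGraph W Λ f h → G (h - z • f) = f

/-- The spectrum of `H`. -/
def hamiltonianSpectrum (W : Config N d → ℝ) (Λ : Set (Config N d)) : Set ℂ :=
  {z | ¬ ∃ G : L2 Λ →L[ℂ] L2 Λ, IsResolvent W Λ z G}

/-- Multiplication by the indicator function of a measurable set `S`, as a linear map. -/
def indicatorLin (Λ S : Set (Config N d)) (hS : MeasurableSet S) : L2 Λ →ₗ[ℂ] L2 Λ where
  toFun f := ((Lp.memLp f).indicator hS).toLp (S.indicator f)
  map_add' f g := by
    rw [← MemLp.toLp_add]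
    refine MemLp.toLp_congr _ _ ?_
    filter_upwards [Lp.coeFn_add f g] with x hx
    by_cases hxS : x ∈ S
    · simpa [hxS] using hx
    · simp [hxS]
  map_smul' c f := by
    simp only [RingHom.id_apply]
    rw [← MemLp.toLp_const_smul]
    refine MemLp.toLp_congr _ _ ?_
    filter_upwards [Lp.coeFn_smul c f] with x hx
    by_cases hxS : x ∈ S
    · simpa [hxS] using hx
    · simp [hxS]

lemma norm_indicatorLin_le (Λ S : Set (Config N d)) (hS : MeasurableSet S) (f : L2 Λ) :
    ‖indicatorLin Λ S hS f‖ ≤ 1 * ‖f‖ := by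
  have hf : MemLp (S.indicator f) 2 (volume.restrict Λ) := (Lp.memLp f).indicator hS
  have h : indicatorLin Λ S hS f = hf.toLp := rfl
  rw [h, one_mul, Lp.norm_toLp, Lp.norm_def]
  exact ENNReal.toReal_mono (Lp.eLpNorm_ne_top f) (eLpNorm_indicator_le _)

/-- Multiplication by the indicator function of a measurable set `S`, as a bounded operator. -/
def indicatorOp (Λ S : Set (Config N d)) (hS : MeasurableSet S) : L2 Λ →L[ℂ] L2 Λ :=
  (indicatorLin Λ S hS).mkContinuous 1 (norm_indicatorLin_le Λ S hS)

lemma measurableSet_cell (u : Lattice N d) : MeasurableSet (cell u) := by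
  have h : Measurable fun x : Config N d => ‖x - u.toConfig‖ := by fun_prop
  exact measurableSet_le h measurable_const

lemma measurableSet_belt (u : Lattice N d) (L : ℕ) : MeasurableSet (belt u L) := by
  have h : Measurable fun x : Config N d => ‖x - u.toConfig‖ := by fun_prop
  exact (measurableSet_lt measurable_const h).inter (measurableSet_lt h measurable_const)

/-! ### Nonsingular, nonresonant, weakly interactive and good cubes -/

/-- The cube of radius `L` centred at `u` is `(E,m)`-nonsingular: `E` is in the resolvent set, and
`C_geom (3L)^{Nd} ‖1_belt (H - E)⁻¹ χ_u‖ ≤ exp (-m L)`. -/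
def IsNonsingular (C_geom : ℝ) (W : Config N d → ℝ) (E m : ℝ) (u : Lattice N d) (L : ℕ) : Prop :=
  ∃ G : L2 (cube u L) →L[ℂ] L2 (cube u L), IsResolvent W (cube u L) (E : ℂ) G ∧
    C_geom * (3 * (L : ℝ)) ^ (N * d) *
      ‖(indicatorOp (cube u L) (belt u L) (measurableSet_belt u L)).comp
        (G.comp (indicatorOp (cube u L) (cell u) (measurableSet_cell u)))‖
      ≤ Real.exp (-(m * L))

/-- The cube of radius `L` centred at `u` is `(E,β)`-nonresonant: the distance from `E` to the
spectrum is at least `exp (-L^β)`. -/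
def IsNonresonant (W : Config N d → ℝ) (E β : ℝ) (u : Lattice N d) (L : ℕ) : Prop :=
  ∀ z ∈ hamiltonianSpectrum W (cube u L), Real.exp (-((L : ℝ) ^ β)) ≤ ‖z - (E : ℂ)‖

/-- The cube of radius `L` centred at `u` is weakly interactive. -/
def IsWeaklyInteractive (τ : ℝ) (u : Lattice N d) (L : ℕ) : Prop :=
  ∃ i j : Fin N, i ≠ j ∧ 3 * (N : ℝ) * (L : ℝ) ^ τ ≤ ‖u.toConfig i - u.toConfig j‖

/-- The distance between two sets is at least `R`. -/
def AreDistant (R : ℝ) (A B : Set (Config N d)) : Prop :=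
  ∀ x ∈ A, ∀ y ∈ B, R ≤ dist x y

/-- The cube of radius `L'` centred at `u` contains a weakly interactive `(E,m)`-singular cube of
radius `L`, or at least `K + 1` pairwise `9 N L^τ`-distant strongly interactive `(E,m)`-singular
cubes of radius `L`. -/
def IsBad (C_geom : ℝ) (W : Config N d → ℝ) (τ : ℝ) (K : ℕ) (E m : ℝ) (u : Lattice N d)
    (L L' : ℕ) : Prop :=
  (∃ w : Lattice N d, cube w L ⊆ cube u L' ∧ IsWeaklyInteractive τ w L ∧
    ¬ IsNonsingular C_geom W E m w L) ∨
  ∃ s : Finset (Lattice N d), K + 1 ≤ s.card ∧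
    (∀ w ∈ s, cube w L ⊆ cube u L' ∧ ¬ IsWeaklyInteractive τ w L ∧
      ¬ IsNonsingular C_geom W E m w L) ∧
    ∀ w ∈ s, ∀ w' ∈ s, w ≠ w' → AreDistant (9 * (N : ℝ) * (L : ℝ) ^ τ) (cube w L) (cube w' L)

/-- The length scales `L_k = L_0 ^ (α ^ k)`. -/
def scale (L₀ α k : ℕ) : ℕ := L₀ ^ (α ^ k)

end MultiParticle

end

/-! The proof is one deterministic step from the length `l` to `L = l ^ α`, valid for every `l`
beyond a threshold. It expands the resolvent `G` of the large cube radially, between its centre and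
its boundary.

The basic tool is a geometric resolvent inequality (`exists_isCutConstant`). If `f'` solves the
equation in a region `Λ'` and `ψ` cuts it off inside a belt, then `ψ f'` solves the equation in `Λ`
up to a commutator supported in the belt. An interior energy estimate bounds this commutator by `f'`
on the belt. Since `W ≥ 0` may be dropped there, the constant depends only on `N`, `d` and the upper
bound on the energy, and so is uniform in the amplitudes. Hence the resolvent between two sets
separated by a belt factorizes at the belt (`IsCutConstant.offDiag_le_mul`), and a nonsingular cube
of radius `l` gains its decay factor (`IsCutConstant.offDiag_cell_le`).

The large cube is divided into shells of width `l ^ 2`; there are `X - 2` of them, where `L = l ^ 2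
* X`. In a good cube, a maximal separated family of singular cubes has at most `K` members, and
every singular cube lies near one of them. So singular cubes touch only `b` shells with `l * b ≤ c_b
* X` (`exists_bad_shells`, `bad_shells_le`). A bad shell is crossed with the norm bound `‖G‖ ≤ exp
(L ^ β) ≤ exp l`, which nonresonance provides. A clean shell is crossed by walking from its middle
to both edges in about `l` steps of length `l` (`IsControlledResolvent.offDiag_belt_le`).

The rate `m` must survive without any loss, and the reason is a surplus per step. Nonsingularity is
normalized by the volume factor `(3l) ^ (N * d)`, whereas passing from a belt to its cells costs
only the square root of the number of cells, by orthogonality. Each step therefore gains `exp (-(m *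
l + g))` with `g` about `log l / 2` (`stepFactor_le_exp`). There are at least `l * X / 4` such
steps, so the surplus is at least `g * l * X / 4`. All losses, namely the norm bounds, the volume
factors, the bad shells and the rounding, are `O(l * X)` in the exponent, because `m ≤ M`. Hence `g`
wins once `log l` is large (`exponent_estimate`). -/

noncomputable section

namespace MultiParticle

variable {N d : ℕ}

/-! ### Test functions -/

/-- The coordinate vector of the `j`-th coordinate of the `i`-th particle. -/
def coordVec (i : Fin N) (j : Fin d) : Config N d := Pi.single i (Pi.single j 1)

lemma pderiv_eq (i : Fin N) (j : Fin d) (η : Config N d → ℂ) (x : Config N d) :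
    pderiv i j η x = fderiv ℝ η x (coordVec i j) := rfl

/-- The partial derivative of a real function. -/
def rderiv (i : Fin N) (j : Fin d) (ψ : Config N d → ℝ) (x : Config N d) : ℝ :=
  fderiv ℝ ψ x (coordVec i j)

lemma IsTest.continuous {Λ : Set (Config N d)} {η : Config N d → ℂ} (h : IsTest Λ η) :
    Continuous η := h.1.continuous

lemma IsTest.differentiableAt {Λ : Set (Config N d)} {η : Config N d → ℂ} (h : IsTest Λ η)
    (x : Config N d) : DifferentiableAt ℝ η x :=
  (h.1.differentiable (by simp)) x

lemma IsTest.pderiv {Λ : Set (Config N d)} {η : Config N d → ℂ} (h : IsTest Λ η)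
    (i : Fin N) (j : Fin d) : IsTest Λ (pderiv i j η) := by
  refine ⟨?_, h.2.1.fderiv_apply ℝ (coordVec i j), ?_⟩
  · exact (h.1.fderiv_right (m := ∞) (by simp)).clm_apply contDiff_const
  · refine (closure_mono ?_).trans ((tsupport_fderiv_subset ℝ).trans h.2.2)
    intro x hx hx'
    exact hx (by rw [pderiv_eq, hx']; rfl)

lemma IsTest.memLp {Λ : Set (Config N d)} {η : Config N d → ℂ} (h : IsTest Λ η)
    (μ : Measure (Config N d)) [IsFiniteMeasureOnCompacts μ] (p : ENNReal) : MemLp η p μ :=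
  h.continuous.memLp_of_hasCompactSupport h.2.1

lemma IsTest.eq_zero {Λ : Set (Config N d)} {η : Config N d → ℂ} (h : IsTest Λ η)
    {x : Config N d} (hx : x ∉ Λ) : η x = 0 :=
  image_eq_zero_of_notMem_tsupport fun h' => hx (h.2.2 h')

lemma IsTest.smul {Λ Λ' : Set (Config N d)} {η : Config N d → ℂ} (h : IsTest Λ η)
    {ψ : Config N d → ℝ} (hψ : ContDiff ℝ ∞ ψ) (hs : tsupport ψ ∩ Λ ⊆ Λ') :
    IsTest Λ' (fun x => ψ x • η x) := by
  refine ⟨ContDiff.smul hψ h.1, HasCompactSupport.smul_left (f := ψ) (f' := η) h.2.1, fun x hx => hs ⟨?_, h.2.2 ?_⟩⟩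
  · exact tsupport_smul_subset_left ψ η hx
  · exact tsupport_smul_subset_right ψ η hx

lemma IsTest.conj {Λ : Set (Config N d)} {η : Config N d → ℂ} (h : IsTest Λ η) :
    IsTest Λ (fun x => (starRingEnd ℂ) (η x)) := by
  refine ⟨Complex.conjCLE.contDiff.comp h.1, h.2.1.comp_left (map_zero _), ?_⟩
  refine (closure_mono ?_).trans h.2.2
  intro x hx hx'
  exact hx (by simp [hx'])

lemma IsTest.pderiv_conj {Λ : Set (Config N d)} {η : Config N d → ℂ} (h : IsTest Λ η)
    (i : Fin N) (j : Fin d) (x : Config N d) :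
    MultiParticle.pderiv i j (fun x => (starRingEnd ℂ) (η x)) x
      = (starRingEnd ℂ) (MultiParticle.pderiv i j η x) := by
  have := (Complex.conjCLE.hasFDerivAt (x := η x)).comp x (h.differentiableAt x).hasFDerivAt
  have h2 : fderiv ℝ (fun x => (starRingEnd ℂ) (η x)) x = _ := this.fderiv
  rw [pderiv_eq, h2]; rfl

lemma IsTest.pderiv_smul {Λ : Set (Config N d)} {η : Config N d → ℂ} (h : IsTest Λ η)
    {ψ : Config N d → ℝ} (hψ : ContDiff ℝ ∞ ψ) (i : Fin N) (j : Fin d) (x : Config N d) :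
    MultiParticle.pderiv i j (fun x => ψ x • η x) x
      = ψ x • MultiParticle.pderiv i j η x + rderiv i j ψ x • η x := by
  rw [pderiv_eq, fderiv_fun_smul (hψ.differentiable (by simp) x) (h.differentiableAt x)]
  simp [pderiv_eq, rderiv]

lemma IsTest.integral_pderiv_mul {Λ Λ' : Set (Config N d)} {η θ : Config N d → ℂ}
    (h : IsTest Λ η) (h' : IsTest Λ' θ) (i : Fin N) (j : Fin d) :
    ∫ x, η x * MultiParticle.pderiv i j θ x = - ∫ x, MultiParticle.pderiv i j η x * θ x := by
  refine integral_mul_fderiv_eq_neg_fderiv_mul_of_integrable (μ := volume) (v := coordVec i j)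
    ?_ ?_ ?_ (fun x _ => h.differentiableAt x) (fun x _ => h'.differentiableAt x)
  · exact ((h.pderiv i j).memLp volume 2).integrable_mul (h'.memLp volume 2)
  · exact (h.memLp volume 2).integrable_mul ((h'.pderiv i j).memLp volume 2)
  · exact (h.memLp volume 2).integrable_mul (h'.memLp volume 2)

/-! ### Convergence in mean square -/

lemma norm_integral_mul_le {μ : Measure (Config N d)} {u v : Config N d → ℂ}
    (hu : MemLp u 2 μ) (hv : MemLp v 2 μ) :
    ‖∫ x, u x * v x ∂μ‖ₑ ≤ eLpNorm u 2 μ * eLpNorm v 2 μ := by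
  refine (enorm_integral_le_lintegral_enorm _).trans ?_
  rw [← eLpNorm_one_eq_lintegral_enorm]
  have h := eLpNorm_smul_le_mul_eLpNorm (p := 2) (q := 2) (r := 1) hv.1 hu.1
  exact h

lemma tendsto_integral_mul {μ : Measure (Config N d)} {u : ℕ → Config N d → ℂ}
    {u₀ v : Config N d → ℂ} (hu : ∀ n, MemLp (u n) 2 μ) (hu₀ : MemLp u₀ 2 μ) (hv : MemLp v 2 μ)
    (h : Tendsto (fun n => eLpNorm (fun x => u n x - u₀ x) 2 μ) atTop (𝓝 0)) :
    Tendsto (fun n => ∫ x, u n x * v x ∂μ) atTop (𝓝 (∫ x, u₀ x * v x ∂μ)) := by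
  rw [tendsto_iff_edist_tendsto_0]
  have hlim : Tendsto (fun n => eLpNorm (fun x => u n x - u₀ x) 2 μ * eLpNorm v 2 μ) atTop
      (𝓝 0) := by
    have := ENNReal.Tendsto.mul_const (b := eLpNorm v 2 μ) h (Or.inr hv.2.ne)
    simpa using this
  refine tendsto_of_tendsto_of_tendsto_of_le_of_le tendsto_const_nhds hlim (fun n => zero_le)
    (fun n => ?_)
  have h1 : ∫ x, u n x * v x ∂μ - ∫ x, u₀ x * v x ∂μ = ∫ x, (u n x - u₀ x) * v x ∂μ := by
    have h2 := integral_sub ((hu n).integrable_mul hv) (hu₀.integrable_mul hv)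
    simp only [Pi.mul_apply] at h2
    simp only [sub_mul, h2]
  simp only [edist_eq_enorm_sub, h1]
  exact norm_integral_mul_le ((hu n).sub hu₀) hv

/-! ### The space `H¹₀` at the level of functions -/

/-- `f` lies in `H¹₀(Λ)` and has gradient `g`. -/
structure IsH10 (Λ : Set (Config N d)) (f : Config N d → ℂ) (g : Fin N → Fin d → Config N d → ℂ) :
    Prop where
  memLp : MemLp f 2 (volume.restrict Λ)
  memLp_grad : ∀ i j, MemLp (g i j) 2 (volume.restrict Λ)
  approx : ∃ η : ℕ → Config N d → ℂ, (∀ n, IsTest Λ (η n)) ∧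
    Tendsto (fun n => eLpNorm (fun x => η n x - f x) 2 (volume.restrict Λ)) atTop (𝓝 0) ∧
    ∀ i j, Tendsto (fun n => eLpNorm (fun x => pderiv i j (η n) x - g i j x) 2
      (volume.restrict Λ)) atTop (𝓝 0)

lemma HasH10Gradient.isH10 {Λ : Set (Config N d)} {f : L2 Λ} {g : Fin N → Fin d → L2 Λ}
    (h : HasH10Gradient Λ f g) : IsH10 Λ f (fun i j => g i j) :=
  ⟨Lp.memLp f, fun i j => Lp.memLp (g i j), h⟩

lemma IsH10.congr {Λ : Set (Config N d)} {f f' : Config N d → ℂ}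
    {g g' : Fin N → Fin d → Config N d → ℂ} (h : IsH10 Λ f g)
    (hf : f =ᵐ[volume.restrict Λ] f') (hg : ∀ i j, g i j =ᵐ[volume.restrict Λ] g' i j) :
    IsH10 Λ f' g' := by
  obtain ⟨η, h1, h2, h3⟩ := h.approx
  refine ⟨h.memLp.ae_eq hf, fun i j => (h.memLp_grad i j).ae_eq (hg i j), η, h1, ?_, fun i j => ?_⟩
  · refine h2.congr fun n => eLpNorm_congr_ae ?_
    filter_upwards [hf] with x hx
    rw [hx]
  · refine (h3 i j).congr fun n => eLpNorm_congr_ae ?_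
    filter_upwards [hg i j] with x hx
    rw [hx]

lemma IsH10.conj {Λ : Set (Config N d)} {f : Config N d → ℂ}
    {g : Fin N → Fin d → Config N d → ℂ} (h : IsH10 Λ f g) :
    IsH10 Λ (fun x => (starRingEnd ℂ) (f x)) (fun i j x => (starRingEnd ℂ) (g i j x)) := by
  obtain ⟨η, h1, h2, h3⟩ := h.approx
  refine ⟨h.memLp.star, fun i j => (h.memLp_grad i j).star, _, fun n => (h1 n).conj, ?_,
    fun i j => ?_⟩
  · refine h2.congr fun n => eLpNorm_congr_norm_ae (ae_of_all _ fun x => ?_)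
    rw [← map_sub, RCLike.norm_conj]
  · refine (h3 i j).congr fun n => eLpNorm_congr_norm_ae (ae_of_all _ fun x => ?_)
    rw [(h1 n).pderiv_conj, ← map_sub, RCLike.norm_conj]

/-- Both sides are continuous under the approximation by test functions, for which this is
integration by parts. So the gradient in `IsH10` is the weak gradient. -/
lemma IsH10.integral_mul_pderiv {Λ : Set (Config N d)} {f : Config N d → ℂ}
    {g : Fin N → Fin d → Config N d → ℂ} (h : IsH10 Λ f g) {θ : Config N d → ℂ} (hθ : IsTest Λ θ)
    (i : Fin N) (j : Fin d) :
    ∫ x in Λ, f x * MultiParticle.pderiv i j θ x = - ∫ x in Λ, g i j x * θ x := by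
  obtain ⟨η, h1, h2, h3⟩ := h.approx
  have e1 := tendsto_integral_mul (fun n => (h1 n).memLp _ 2) h.memLp
    ((hθ.pderiv i j).memLp (volume.restrict Λ) 2) h2
  have e2 := (tendsto_integral_mul (fun n => ((h1 n).pderiv i j).memLp _ 2) (h.memLp_grad i j)
    (hθ.memLp (volume.restrict Λ) 2) (h3 i j)).neg
  refine tendsto_nhds_unique e1 (e2.congr fun n => ?_)
  -- Test functions vanish off `Λ`, so the identity may be checked on the whole space, where no
  -- boundary terms arise.
  rw [setIntegral_eq_integral_of_forall_compl_eq_zero, setIntegral_eq_integral_of_forall_compl_eq_zero,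
    (h1 n).integral_pderiv_mul hθ]
  · intro x hx; rw [(hθ.pderiv i j).eq_zero hx, mul_zero]
  · intro x hx; rw [hθ.eq_zero hx, mul_zero]

/-! ### Multiplication by smooth functions -/

/-- A smooth function that is bounded by `B` together with its first and its pure second partial
derivatives. -/
structure IsCutoff (ψ : Config N d → ℝ) (B : ℝ) : Prop where
  contDiff : ContDiff ℝ ∞ ψ
  le : ∀ x, |ψ x| ≤ B
  rderiv_le : ∀ i j x, |rderiv i j ψ x| ≤ B
  rderiv_rderiv_le : ∀ i j x, |rderiv i j (rderiv i j ψ) x| ≤ B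

lemma contDiff_rderiv {ψ : Config N d → ℝ} (hψ : ContDiff ℝ ∞ ψ) (i : Fin N) (j : Fin d) :
    ContDiff ℝ ∞ (rderiv i j ψ) :=
  (hψ.fderiv_right (m := ∞) (by simp)).clm_apply contDiff_const

lemma tsupport_rderiv_subset (ψ : Config N d → ℝ) (i : Fin N) (j : Fin d) :
    tsupport (rderiv i j ψ) ⊆ tsupport ψ := by
  refine (closure_mono ?_).trans (tsupport_fderiv_subset ℝ)
  intro x hx hx'
  exact hx (by rw [rderiv, hx']; rfl)

lemma memLp_smul_of_bdd {μ : Measure (Config N d)} {ψ : Config N d → ℝ} {B : ℝ}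
    (hψ : Continuous ψ) (hB : ∀ x, |ψ x| ≤ B) {f : Config N d → ℂ} (hf : MemLp f 2 μ) :
    MemLp (fun x => ψ x • f x) 2 μ := by
  refine hf.of_le_mul (c := B) (hψ.aestronglyMeasurable.smul hf.1) (ae_of_all _ fun x => ?_)
  rw [norm_smul]
  exact mul_le_mul_of_nonneg_right (hB x) (norm_nonneg _)

lemma memLp_indicator_of_subset {Λ Λ' : Set (Config N d)} (hΛ : MeasurableSet Λ) (h : Λ ⊆ Λ')
    {f : Config N d → ℂ} (hf : MemLp f 2 (volume.restrict Λ)) :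
    MemLp (Λ.indicator f) 2 (volume.restrict Λ') := by
  rw [memLp_indicator_iff_restrict hΛ, Measure.restrict_restrict_of_subset h]
  exact hf

lemma tendsto_eLpNorm_indicator {Λ Λ' : Set (Config N d)} (hΛ : MeasurableSet Λ) (hsub : Λ ⊆ Λ')
    {B : ℝ} {u w : ℕ → Config N d → ℂ} {v : Config N d → ℂ}
    (hu : ∀ n x, x ∉ Λ → u n x = 0) (hw : ∀ n x, ‖u n x - v x‖ ≤ B * ‖w n x‖)
    (h : Tendsto (fun n => eLpNorm (w n) 2 (volume.restrict Λ)) atTop (𝓝 0)) :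
    Tendsto (fun n => eLpNorm (fun x => u n x - Λ.indicator v x) 2 (volume.restrict Λ')) atTop
      (𝓝 0) := by
  have hlim : Tendsto (fun n => ENNReal.ofReal B * eLpNorm (w n) 2 (volume.restrict Λ)) atTop
      (𝓝 0) := by
    have := ENNReal.Tendsto.const_mul (a := ENNReal.ofReal B) h (Or.inr ENNReal.ofReal_ne_top)
    simpa using this
  refine tendsto_of_tendsto_of_tendsto_of_le_of_le tendsto_const_nhds hlim (fun n => zero_le)
    (fun n => ?_)
  have e : (fun x => u n x - Λ.indicator v x) = Λ.indicator (fun x => u n x - v x) := by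
    ext x
    by_cases hx : x ∈ Λ
    · simp [hx]
    · simp [hx, hu n x hx]
  simp only [e]
  rw [eLpNorm_indicator_eq_eLpNorm_restrict hΛ, Measure.restrict_restrict_of_subset hsub]
  exact eLpNorm_le_mul_eLpNorm_of_ae_le_mul (ae_of_all _ (hw n)) 2

/-- Multiplying the approximating test functions by `ψ` approximates the product. Extension by zero
from `Λ` needs no support condition on `ψ`, since test functions in `Λ` are already test functions
in `Λ'`. -/
lemma IsH10.smul {Λ Λ' : Set (Config N d)} (hΛ : MeasurableSet Λ) (hsub : Λ ⊆ Λ')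
    {f : Config N d → ℂ} {g : Fin N → Fin d → Config N d → ℂ} (h : IsH10 Λ f g)
    {ψ : Config N d → ℝ} {B : ℝ} (hψ : ContDiff ℝ ∞ ψ) (hB : ∀ x, |ψ x| ≤ B)
    (hB' : ∀ i j x, |rderiv i j ψ x| ≤ B) :
    IsH10 Λ' (Λ.indicator fun x => ψ x • f x)
      (fun i j => Λ.indicator fun x => ψ x • g i j x + rderiv i j ψ x • f x) := by
  obtain ⟨η, h1, h2, h3⟩ := h.approx
  have hB0 : 0 ≤ B := (abs_nonneg _).trans (hB 0)
  refine ⟨memLp_indicator_of_subset hΛ hsub (memLp_smul_of_bdd hψ.continuous hB h.memLp),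
    fun i j => memLp_indicator_of_subset hΛ hsub
      ((memLp_smul_of_bdd hψ.continuous hB (h.memLp_grad i j)).add
        (memLp_smul_of_bdd (contDiff_rderiv hψ i j).continuous (hB' i j) h.memLp)),
    fun n x => ψ x • η n x,
    fun n => (h1 n).smul hψ (Set.inter_subset_right.trans hsub), ?_, fun i j => ?_⟩
  · refine tendsto_eLpNorm_indicator hΛ hsub (B := B) (fun n x hx => ?_) (fun n x => ?_) h2
    · simp [(h1 n).eq_zero hx]
    · rw [← smul_sub, norm_smul]
      exact mul_le_mul_of_nonneg_right (hB x) (norm_nonneg _)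
  · have h4 : Tendsto (fun n => eLpNorm (fun x => ‖pderiv i j (η n) x - g i j x‖
        + ‖η n x - f x‖) 2 (volume.restrict Λ)) atTop (𝓝 0) := by
      have hs := (h3 i j).add h2
      rw [add_zero] at hs
      refine tendsto_of_tendsto_of_tendsto_of_le_of_le tendsto_const_nhds hs (fun n => zero_le)
        (fun n => ?_)
      have m1 := ((((h1 n).pderiv i j).memLp (volume.restrict Λ) 2).sub (h.memLp_grad i j))
      have m2 := (((h1 n).memLp (volume.restrict Λ) 2).sub h.memLp)
      refine (eLpNorm_add_le m1.1.norm m2.1.norm (by norm_num)).trans (le_of_eq ?_)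
      congr 1
      · exact eLpNorm_norm _
      · exact eLpNorm_norm _
    refine tendsto_eLpNorm_indicator (w := fun n x => ((‖pderiv i j (η n) x - g i j x‖
        + ‖η n x - f x‖ : ℝ) : ℂ)) hΛ hsub (B := B) (fun n x hx => ?_) (fun n x => ?_) ?_
    · rw [(h1 n).pderiv_smul hψ, ((h1 n).pderiv i j).eq_zero hx, (h1 n).eq_zero hx]; simp
    · rw [(h1 n).pderiv_smul hψ, add_sub_add_comm, ← smul_sub, ← smul_sub, Complex.norm_real,
        Real.norm_of_nonneg (by positivity), mul_add]
      refine (norm_add_le _ _).trans (add_le_add ?_ ?_)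
      · rw [norm_smul]
        exact mul_le_mul_of_nonneg_right (hB x) (norm_nonneg _)
      · rw [norm_smul]
        exact mul_le_mul_of_nonneg_right (hB' i j x) (norm_nonneg _)
    · refine h4.congr fun n => eLpNorm_congr_norm_ae (ae_of_all _ fun x => ?_)
      rw [Complex.norm_real]

/-! ### Bounded potentials -/

/-- A measurable potential with values in `[0, B]` almost everywhere. -/
structure IsBoundedPotential (W : Config N d → ℝ) (B : ℝ) : Prop where
  measurable : Measurable W
  nonneg : ∀ᵐ x, 0 ≤ W x
  le : ∀ᵐ x, W x ≤ B

lemma measurable_alloy {φ : (Fin d → ℤ) → (Fin d → ℝ) → ℝ} {r₁ C_φ : ℝ}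
    (hφ : IsFlatTiling φ r₁ C_φ) {v : (Fin d → ℤ) → ℝ} (hv : ∀ a, 0 ≤ v a) :
    Measurable (alloy φ v) := by
  -- The identity holds at every `x`: where the series diverges, both sides take the default value
  -- `0`.
  have e : alloy φ v = fun x => (∑' a : Fin d → ℤ,
      ENNReal.ofReal (v a * φ a (x - fun j => (a j : ℝ)))).toReal := by
    ext x
    rw [ENNReal.tsum_toReal_eq fun a => ENNReal.ofReal_ne_top]
    refine tsum_congr fun a => ?_
    rw [ENNReal.toReal_ofReal (mul_nonneg (hv a) (hφ.nonneg a _))]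
  rw [e]
  refine (Measurable.tsum fun a => ?_).ennreal_toReal
  exact (((hφ.measurable a).comp (measurable_id.sub_const _)).const_mul _).ennreal_ofReal

lemma alloy_nonneg {φ : (Fin d → ℤ) → (Fin d → ℝ) → ℝ} {r₁ C_φ : ℝ}
    (hφ : IsFlatTiling φ r₁ C_φ) {v : (Fin d → ℤ) → ℝ} (hv : ∀ a, 0 ≤ v a) (x : Fin d → ℝ) :
    0 ≤ alloy φ v x :=
  tsum_nonneg fun a => mul_nonneg (hv a) (hφ.nonneg a _)

lemma alloy_le {φ : (Fin d → ℤ) → (Fin d → ℝ) → ℝ} {r₁ C_φ c_V : ℝ}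
    (hφ : IsFlatTiling φ r₁ C_φ) {v : (Fin d → ℤ) → ℝ} (hv : ∀ a, v a ∈ Set.Icc 0 c_V) :
    ∀ᵐ x, alloy φ v x ≤ c_V * C_φ := by
  filter_upwards [hφ.tiling] with x hx
  have h1 := hx.mul_left c_V
  have h2 : ∀ a, v a * φ a (x - fun j => (a j : ℝ)) ≤ c_V * φ a (x - fun j => (a j : ℝ)) :=
    fun a => mul_le_mul_of_nonneg_right (hv a).2 (hφ.nonneg a _)
  have h3 : Summable fun a => v a * φ a (x - fun j => (a j : ℝ)) :=
    h1.summable.of_nonneg_of_le (fun a => mul_nonneg (hv a).1 (hφ.nonneg a _)) h2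
  rw [← h1.tsum_eq]
  exact h3.tsum_le_tsum h2 h1.summable

/-- The flat tiling bounds the alloy part, and the interaction is at most `C_U` per pair. The upper
bound serves only integrability; the quantitative estimates use the sign. -/
lemma isBoundedPotential_potential {U : ℝ → ℝ} {ζ C_U : ℝ} (hU : IsInteraction U ζ C_U)
    {φ : (Fin d → ℤ) → (Fin d → ℝ) → ℝ} {r₁ C_φ c_V : ℝ} (hφ : IsFlatTiling φ r₁ C_φ)
    {v : (Fin d → ℤ) → ℝ} (hv : ∀ a, v a ∈ Set.Icc 0 c_V) :
    ∃ B, IsBoundedPotential (potential (N := N) U φ v) B := by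
  refine ⟨(∑ i : Fin N, ∑ j ∈ Finset.univ.filter (fun j => i < j), C_U)
    + ∑ _i : Fin N, c_V * C_φ, ?_, ?_, ?_⟩
  · have h1 : Measurable (alloy φ v) := measurable_alloy hφ fun a => (hv a).1
    have h2 := hU.measurable
    unfold potential
    refine Measurable.add (Finset.measurable_fun_sum _ fun i _ =>
      Finset.measurable_fun_sum _ fun j _ => h2.comp ?_)
      (Finset.measurable_fun_sum _ fun i _ => h1.comp (measurable_pi_apply i))
    exact ((measurable_pi_apply i).sub (measurable_pi_apply j)).norm
  · refine ae_of_all _ fun x => add_nonneg (Finset.sum_nonneg fun i _ =>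
      Finset.sum_nonneg fun j _ => hU.nonneg _ (norm_nonneg _))
      (Finset.sum_nonneg fun i _ => alloy_nonneg hφ (fun a => (hv a).1) _)
  · have h : ∀ i : Fin N, ∀ᵐ x : Config N d, alloy φ v (x i) ≤ c_V * C_φ := fun i =>
      (Measure.quasiMeasurePreserving_eval (fun _ : Fin N => (volume : Measure (Fin d → ℝ)))
        i).ae (alloy_le hφ hv)
    filter_upwards [ae_all_iff.2 h] with x hx
    refine add_le_add (Finset.sum_le_sum fun i _ => Finset.sum_le_sum fun j _ => ?_)
      (Finset.sum_le_sum fun i _ => hx i)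
    refine (hU.le _ (norm_nonneg _)).trans ?_
    have : Real.exp (-(‖x i - x j‖ ^ ζ)) ≤ 1 :=
      Real.exp_le_one_iff.2 (neg_nonpos.2 (Real.rpow_nonneg (norm_nonneg _) _))
    simpa using mul_le_mul_of_nonneg_left this hU.const_pos.le

lemma IsBoundedPotential.memLp_mul {W : Config N d → ℝ} {B : ℝ} (hW : IsBoundedPotential W B)
    {Λ : Set (Config N d)} {f : Config N d → ℂ} (hf : MemLp f 2 (volume.restrict Λ)) :
    MemLp (fun x => (W x : ℂ) * f x) 2 (volume.restrict Λ) := by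
  refine hf.of_le_mul (c := B)
    ((Complex.measurable_ofReal.comp hW.measurable).aestronglyMeasurable.mul hf.1) ?_
  filter_upwards [ae_restrict_of_ae hW.nonneg, ae_restrict_of_ae hW.le] with x h0 h1
  rw [norm_mul, Complex.norm_real, Real.norm_of_nonneg h0]
  exact mul_le_mul_of_nonneg_right h1 (norm_nonneg _)

/-! ### Weak solutions -/

/-- `f` has gradient `g`, lies in `H¹₀(Λ)` and satisfies `(-Δ/2 + W) f = h` weakly in `Λ`. -/
structure IsWeakSolution (W : Config N d → ℝ) (Λ : Set (Config N d)) (f : Config N d → ℂ)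
    (g : Fin N → Fin d → Config N d → ℂ) (h : Config N d → ℂ) : Prop where
  isH10 : IsH10 Λ f g
  memLp_rhs : MemLp h 2 (volume.restrict Λ)
  weak : ∀ η : Config N d → ℂ, IsTest Λ η →
    (1 / 2 : ℂ) * (∑ i, ∑ j, ∫ x in Λ, g i j x * pderiv i j η x)
      + ∫ x in Λ, (W x : ℂ) * f x * η x = ∫ x in Λ, h x * η x

lemma HamiltonianGraph.exists_isWeakSolution {W : Config N d → ℝ} {Λ : Set (Config N d)}
    {f h : L2 Λ} (H : HamiltonianGraph W Λ f h) : ∃ g, IsWeakSolution W Λ f g h := by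
  obtain ⟨g, h1, h2⟩ := H
  exact ⟨_, h1.isH10, Lp.memLp h, h2⟩

lemma IsWeakSolution.hamiltonianGraph {W : Config N d → ℝ} {Λ : Set (Config N d)}
    {f h : Config N d → ℂ} {g : Fin N → Fin d → Config N d → ℂ} (H : IsWeakSolution W Λ f g h)
    {f' h' : L2 Λ} (hf : f =ᵐ[volume.restrict Λ] f') (hh : h =ᵐ[volume.restrict Λ] h') :
    HamiltonianGraph W Λ f' h' := by
  refine ⟨fun i j => (H.isH10.memLp_grad i j).toLp (g i j),
    (H.isH10.congr hf fun i j => (H.isH10.memLp_grad i j).coeFn_toLp.symm).approx,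
    fun η hη => ?_⟩
  have e : ∫ x in Λ, h' x * η x = ∫ x in Λ, h x * η x := integral_congr_ae (by
    filter_upwards [hh] with x hx; rw [hx])
  rw [e, ← H.weak η hη]
  congr 1
  · congr 1
    refine Finset.sum_congr rfl fun i _ => Finset.sum_congr rfl fun j _ => integral_congr_ae ?_
    filter_upwards [(H.isH10.memLp_grad i j).coeFn_toLp] with x hx
    simp only [hx]
  · refine integral_congr_ae ?_
    filter_upwards [hf] with x hx
    rw [hx]

/-- The weak equation may be tested with elements of `H¹₀`. -/
lemma IsWeakSolution.pairing {W : Config N d → ℝ} {B : ℝ} (hW : IsBoundedPotential W B)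
    {Λ : Set (Config N d)} {f h : Config N d → ℂ} {g : Fin N → Fin d → Config N d → ℂ}
    (H : IsWeakSolution W Λ f g h) {f' : Config N d → ℂ}
    {g' : Fin N → Fin d → Config N d → ℂ} (H' : IsH10 Λ f' g') :
    (1 / 2 : ℂ) * (∑ i, ∑ j, ∫ x in Λ, g i j x * g' i j x)
      + ∫ x in Λ, (W x : ℂ) * f x * f' x = ∫ x in Λ, h x * f' x := by
  obtain ⟨η, h1, h2, h3⟩ := H'.approx
  have key : ∀ u : Config N d → ℂ, MemLp u 2 (volume.restrict Λ) →
      Tendsto (fun n => ∫ x in Λ, u x * η n x) atTop (𝓝 (∫ x in Λ, u x * f' x)) := by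
    intro u hu
    have := tendsto_integral_mul (fun n => (h1 n).memLp _ 2) H'.memLp hu h2
    simpa only [mul_comm] using this
  have key' : ∀ i j, Tendsto (fun n => ∫ x in Λ, g i j x * pderiv i j (η n) x) atTop
      (𝓝 (∫ x in Λ, g i j x * g' i j x)) := by
    intro i j
    have := tendsto_integral_mul (fun n => ((h1 n).pderiv i j).memLp _ 2) (H'.memLp_grad i j)
      (H.isH10.memLp_grad i j) (h3 i j)
    simpa only [mul_comm] using this
  have e1 := ((tendsto_finsetSum Finset.univ fun i _ => tendsto_finsetSum Finset.univ
    fun j _ => key' i j).const_mul (1 / 2 : ℂ)).add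
      (key (fun x => (W x : ℂ) * f x) (hW.memLp_mul H.isH10.memLp))
  exact tendsto_nhds_unique e1 ((key h H.memLp_rhs).congr fun n => (H.weak _ (h1 n)).symm)

/-! ### The resolvent -/

lemma inner_eq_integral {Λ : Set (Config N d)} (f h : L2 Λ) :
    inner ℂ f h = ∫ x in Λ, h x * (starRingEnd ℂ) (f x) := by
  rw [L2.inner_def]; rfl

/-- The vector `G' h` solves the equation at `z` with source `h + (w - z) • G' h`, and `G` inverts
that equation. -/
lemma IsResolvent.identity {W : Config N d → ℝ} {Λ : Set (Config N d)} {z w : ℂ}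
    {G G' : L2 Λ →L[ℂ] L2 Λ} (hG : IsResolvent W Λ z G) (hG' : IsResolvent W Λ w G')
    (h : L2 Λ) : G h + (w - z) • G (G' h) = G' h := by
  have := hG.2 _ _ (hG'.1 h)
  rw [← map_smul, ← map_add, sub_smul, ← add_sub_assoc]
  exact this

/-- Each equation is tested with the conjugate of the other solution; both sides then equal the same
Hermitian energy form. -/
lemma IsWeakSolution.symm {W : Config N d → ℝ} {B : ℝ} (hW : IsBoundedPotential W B)
    {Λ : Set (Config N d)} {f h f' h' : Config N d → ℂ} {g g' : Fin N → Fin d → Config N d → ℂ}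
    (H : IsWeakSolution W Λ f g h) (H' : IsWeakSolution W Λ f' g' h') :
    ∫ x in Λ, h x * (starRingEnd ℂ) (f' x)
      = (starRingEnd ℂ) (∫ x in Λ, h' x * (starRingEnd ℂ) (f x)) := by
  rw [← H.pairing hW H'.isH10.conj, ← H'.pairing hW H.isH10.conj, map_add, map_mul, map_sum,
    ← integral_conj]
  congr 1
  · congr 1
    · rw [map_div₀, map_one, map_ofNat]
    · refine Finset.sum_congr rfl fun i _ => ?_
      rw [map_sum]
      refine Finset.sum_congr rfl fun j _ => ?_
      rw [← integral_conj]
      refine integral_congr_ae (ae_of_all _ fun x => ?_)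
      simp only [map_mul, Complex.conj_conj]
      exact mul_comm _ _
  · refine integral_congr_ae (ae_of_all _ fun x => ?_)
    simp only [map_mul, Complex.conj_conj, Complex.conj_ofReal]
    ring

lemma IsResolvent.isSelfAdjoint {W : Config N d → ℝ} {B : ℝ} (hW : IsBoundedPotential W B)
    {Λ : Set (Config N d)} {E : ℝ} {G : L2 Λ →L[ℂ] L2 Λ} (hG : IsResolvent W Λ (E : ℂ) G) :
    IsSelfAdjoint G := by
  rw [ContinuousLinearMap.isSelfAdjoint_iff_isSymmetric]
  intro b a
  obtain ⟨g, hg⟩ := (hG.1 a).exists_isWeakSolution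
  obtain ⟨g', hg'⟩ := (hG.1 b).exists_isWeakSolution
  have e3 := hg.symm hW hg'
  rw [← inner_eq_integral, ← inner_eq_integral, inner_conj_symm, inner_add_left, inner_add_right,
    inner_smul_left, inner_smul_right, Complex.conj_ofReal] at e3
  exact add_right_cancel e3

/-- For the self-adjoint operator `G` the norm is the spectral radius, attained at some `c` in its
spectrum. Then `E + c⁻¹` lies in the spectrum of the Hamiltonian at distance `1 / ‖G‖` from `E`, so
a distance bound is a norm bound. -/
lemma exists_resolvent_of_isNonresonant {W : Config N d → ℝ} {B : ℝ}
    (hW : IsBoundedPotential W B) {E β : ℝ} {u : Lattice N d} {L : ℕ}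
    (h : IsNonresonant W E β u L) :
    ∃ G : L2 (cube u L) →L[ℂ] L2 (cube u L), IsResolvent W (cube u L) (E : ℂ) G ∧
      ‖G‖ ≤ Real.exp ((L : ℝ) ^ β) := by
  have h0 : (E : ℂ) ∉ hamiltonianSpectrum W (cube u L) := by
    intro hE
    have := h _ hE
    rw [sub_self, norm_zero] at this
    exact absurd this (not_le.2 (Real.exp_pos _))
  obtain ⟨G, hG⟩ := not_not.1 h0
  refine ⟨G, hG, ?_⟩
  by_cases hG0 : G = 0
  · rw [hG0, norm_zero]; exact (Real.exp_pos _).le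
  have : Nontrivial (L2 (cube u L) →L[ℂ] L2 (cube u L)) := ⟨⟨G, 0, hG0⟩⟩
  obtain ⟨c, hc, hc'⟩ := spectrum.exists_nnnorm_eq_spectralRadius G
  rw [(hG.isSelfAdjoint hW).spectralRadius_eq_nnnorm] at hc'
  have hcn : ‖c‖ = ‖G‖ := by
    have := ENNReal.coe_inj.1 hc'
    exact congrArg NNReal.toReal this
  have hc0 : c ≠ 0 := by
    rw [← norm_ne_zero_iff, hcn]; exact norm_ne_zero_iff.2 hG0
  have hmem : (E : ℂ) + c⁻¹ ∈ hamiltonianSpectrum W (cube u L) := by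
    rintro ⟨G', hG'⟩
    refine hc ?_
    have i1 : ∀ x, G x + c⁻¹ • G (G' x) = G' x := fun x => by
      simpa using hG.identity hG' x
    have i2 : ∀ x, G' x - c⁻¹ • G' (G x) = G x := fun x => by
      simpa [sub_eq_add_neg] using hG'.identity hG x
    -- With `x` for the Hamiltonian minus `E`, this is the identity `(c - 1/x)⁻¹ = c⁻¹ (1 + c⁻¹ / (x
    -- - c⁻¹))`.
    set R : L2 (cube u L) →L[ℂ] L2 (cube u L) := c⁻¹ • (1 + c⁻¹ • G') with hR
    refine isUnit_iff_exists.2 ⟨R, ?_, ?_⟩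
    · ext1 x
      have h1 : (algebraMap ℂ (L2 (cube u L) →L[ℂ] L2 (cube u L)) c - G) (R x)
          = c • (R x) - G (R x) := by
        rw [Algebra.algebraMap_eq_smul_one]; rfl
      have h2 : R x = c⁻¹ • (x + c⁻¹ • G' x) := rfl
      change (algebraMap ℂ (L2 (cube u L) →L[ℂ] L2 (cube u L)) c - G) (R x) = x
      rw [h1, h2, smul_smul, mul_inv_cancel₀ hc0, one_smul, map_smul, map_add, map_smul, i1]
      abel
    · ext1 x
      have h1 : (algebraMap ℂ (L2 (cube u L) →L[ℂ] L2 (cube u L)) c - G) x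
          = c • x - G x := by
        rw [Algebra.algebraMap_eq_smul_one]; rfl
      change c⁻¹ • ((algebraMap ℂ (L2 (cube u L) →L[ℂ] L2 (cube u L)) c - G) x
        + c⁻¹ • G' ((algebraMap ℂ (L2 (cube u L) →L[ℂ] L2 (cube u L)) c - G) x)) = x
      rw [h1, map_sub, map_smul, smul_sub, smul_smul c⁻¹ c, inv_mul_cancel₀ hc0, one_smul, i2,
        sub_add_cancel, smul_smul, inv_mul_cancel₀ hc0, one_smul]
  have h2 := h _ hmem
  rw [add_sub_cancel_left, norm_inv, hcn, Real.exp_neg] at h2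
  exact (inv_le_inv₀ (Real.exp_pos _) (norm_pos_iff.2 hG0)).1 h2

/-! ### The commutator of the Hamiltonian with a cutoff function -/

/-- The commutator term `∇ψ · g + (Δψ / 2) f`. -/
def commutatorTerm (ψ : Config N d → ℝ) (f : Config N d → ℂ)
    (g : Fin N → Fin d → Config N d → ℂ) (x : Config N d) : ℂ :=
  ∑ i, ∑ j, (rderiv i j ψ x • g i j x + (1 / 2 : ℝ) • rderiv i j (rderiv i j ψ) x • f x)

lemma memLp_commutatorTerm {μ : Measure (Config N d)} {ψ : Config N d → ℝ} {B : ℝ}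
    (hψ : IsCutoff ψ B) {f : Config N d → ℂ} {g : Fin N → Fin d → Config N d → ℂ}
    (hf : MemLp f 2 μ) (hg : ∀ i j, MemLp (g i j) 2 μ) :
    MemLp (commutatorTerm ψ f g) 2 μ := by
  refine memLp_finsetSum _ fun i _ => memLp_finsetSum _ fun j _ => ?_
  have c1 := contDiff_rderiv hψ.contDiff i j
  exact (memLp_smul_of_bdd c1.continuous (hψ.rderiv_le i j) (hg i j)).add
    ((memLp_smul_of_bdd (contDiff_rderiv c1 i j).continuous (hψ.rderiv_rderiv_le i j)
      hf).const_smul (1 / 2 : ℝ))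

lemma setIntegral_indicator_mul {Λ Λ' : Set (Config N d)} (hΛ : MeasurableSet Λ) (hsub : Λ ⊆ Λ')
    (f η : Config N d → ℂ) :
    ∫ x in Λ', Λ.indicator f x * η x = ∫ x in Λ, f x * η x := by
  have e : (fun x => Λ.indicator f x * η x) = Λ.indicator (fun x => f x * η x) := by
    ext x
    by_cases hx : x ∈ Λ <;> simp [hx]
  rw [e, setIntegral_indicator hΛ, Set.inter_eq_self_of_subset_right hsub]

/-- `H (ψ f) = ψ H f - ∇ψ · ∇f - (Δψ / 2) f`, with extension by zero from `Λ` to `Λ'`. -/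
lemma IsWeakSolution.smul {W : Config N d → ℝ}
    {Λ Λ' : Set (Config N d)} (hΛ : MeasurableSet Λ) (hsub : Λ ⊆ Λ')
    {f h : Config N d → ℂ} {g : Fin N → Fin d → Config N d → ℂ} (H : IsWeakSolution W Λ f g h)
    {ψ : Config N d → ℝ} {B : ℝ} (hψ : IsCutoff ψ B) (hs : tsupport ψ ∩ Λ' ⊆ Λ) :
    IsWeakSolution W Λ' (Λ.indicator fun x => ψ x • f x)
      (fun i j => Λ.indicator fun x => ψ x • g i j x + rderiv i j ψ x • f x)
      (Λ.indicator fun x => ψ x • h x - commutatorTerm ψ f g x) := by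
  have hf := H.isH10.memLp
  have hg := H.isH10.memLp_grad
  refine ⟨H.isH10.smul hΛ hsub hψ.contDiff hψ.le hψ.rderiv_le,
    memLp_indicator_of_subset hΛ hsub ((memLp_smul_of_bdd hψ.contDiff.continuous hψ.le
      H.memLp_rhs).sub (memLp_commutatorTerm hψ hf hg)), fun η hη => ?_⟩
  have hηL : MemLp η 2 (volume.restrict Λ) := hη.memLp _ 2
  have hpη : ∀ i j, MemLp (pderiv i j η) 2 (volume.restrict Λ) :=
    fun i j => (hη.pderiv i j).memLp _ 2
  have cψ := hψ.contDiff.continuous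
  have c1 : ∀ i j, Continuous (rderiv i j ψ) :=
    fun i j => (contDiff_rderiv hψ.contDiff i j).continuous
  have c2 : ∀ i j, Continuous (rderiv i j (rderiv i j ψ)) :=
    fun i j => (contDiff_rderiv (contDiff_rderiv hψ.contDiff i j) i j).continuous
  have Ia : ∀ i j, Integrable (fun x => (ψ x • g i j x) * pderiv i j η x) (volume.restrict Λ) :=
    fun i j => (memLp_smul_of_bdd cψ hψ.le (hg i j)).integrable_mul (hpη i j)
  have Ib : ∀ i j, Integrable (fun x => (rderiv i j ψ x • g i j x) * η x) (volume.restrict Λ) :=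
    fun i j => (memLp_smul_of_bdd (c1 i j) (hψ.rderiv_le i j) (hg i j)).integrable_mul hηL
  have Ic : ∀ i j, Integrable (fun x => (rderiv i j ψ x • f x) * pderiv i j η x)
      (volume.restrict Λ) :=
    fun i j => (memLp_smul_of_bdd (c1 i j) (hψ.rderiv_le i j) hf).integrable_mul (hpη i j)
  have Ie : ∀ i j, Integrable (fun x => (rderiv i j (rderiv i j ψ) x • f x) * η x)
      (volume.restrict Λ) :=
    fun i j => (memLp_smul_of_bdd (c2 i j) (hψ.rderiv_rderiv_le i j) hf).integrable_mul hηL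
  have Ih : Integrable (fun x => (ψ x • h x) * η x) (volume.restrict Λ) :=
    (memLp_smul_of_bdd cψ hψ.le H.memLp_rhs).integrable_mul hηL
  -- The support condition on `ψ` turns a test function of the larger set into one of `Λ`, where the
  -- equation is known.
  have hψη : IsTest Λ (fun x => ψ x • η x) := hη.smul hψ.contDiff hs
  have w1 := H.weak _ hψη
  -- Integrating by parts against `∂ψ η` moves the derivative off `η`. This doubles the gradient
  -- part of the commutator and cancels the factor `1/2` of the Laplacian.
  have w2 : ∀ i j, (∫ x in Λ, (rderiv i j ψ x • f x) * pderiv i j η x)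
      + (∫ x in Λ, (rderiv i j (rderiv i j ψ) x • f x) * η x)
      = - ∫ x in Λ, (rderiv i j ψ x • g i j x) * η x := by
    intro i j
    have ht : IsTest Λ (fun x => rderiv i j ψ x • η x) :=
      hη.smul (contDiff_rderiv hψ.contDiff i j)
        ((Set.inter_subset_inter_left _ (tsupport_rderiv_subset ψ i j)).trans hs)
    have e := H.isH10.integral_mul_pderiv ht i j
    rw [← integral_add (Ic i j) (Ie i j)]
    refine Eq.trans (integral_congr_ae (ae_of_all _ fun x => ?_)) (e.trans ?_)
    · beta_reduce
      rw [hη.pderiv_smul (contDiff_rderiv hψ.contDiff i j)]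
      simp only [Complex.real_smul]
      ring
    · congr 1
      refine integral_congr_ae (ae_of_all _ fun x => ?_)
      simp only [Complex.real_smul]
      ring
  have w3 : ∀ i j, ∫ x in Λ, g i j x * pderiv i j (fun x => ψ x • η x) x
      = (∫ x in Λ, (ψ x • g i j x) * pderiv i j η x)
        + ∫ x in Λ, (rderiv i j ψ x • g i j x) * η x := by
    intro i j
    rw [← integral_add (Ia i j) (Ib i j)]
    refine integral_congr_ae (ae_of_all _ fun x => ?_)
    beta_reduce
    rw [hη.pderiv_smul hψ.contDiff]
    simp only [Complex.real_smul]
    ring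
  have w4 : ∀ i j, ∫ x in Λ', (Λ.indicator fun x => ψ x • g i j x + rderiv i j ψ x • f x) x
        * pderiv i j η x
      = (∫ x in Λ, (ψ x • g i j x) * pderiv i j η x)
        + ∫ x in Λ, (rderiv i j ψ x • f x) * pderiv i j η x := by
    intro i j
    rw [setIntegral_indicator_mul hΛ hsub, ← integral_add (Ia i j) (Ic i j)]
    refine integral_congr_ae (ae_of_all _ fun x => ?_)
    simp only [add_mul]
  have w5 : ∫ x in Λ', (W x : ℂ) * (Λ.indicator fun x => ψ x • f x) x * η x
      = ∫ x in Λ, (W x : ℂ) * f x * (ψ x • η x) := by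
    have e : (fun x => (W x : ℂ) * (Λ.indicator fun x => ψ x • f x) x * η x)
        = fun x => (Λ.indicator fun x => ψ x • f x) x * ((W x : ℂ) * η x) := by
      ext x; ring
    rw [e, setIntegral_indicator_mul hΛ hsub]
    refine integral_congr_ae (ae_of_all _ fun x => ?_)
    simp only [Complex.real_smul]
    ring
  have w6 : ∫ x in Λ', (Λ.indicator fun x => ψ x • h x - commutatorTerm ψ f g x) x * η x
      = (∫ x in Λ, h x * (ψ x • η x)) - ∑ i, ∑ j, ((∫ x in Λ, (rderiv i j ψ x • g i j x) * η x)
        + (1 / 2 : ℂ) * ∫ x in Λ, (rderiv i j (rderiv i j ψ) x • f x) * η x) := by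
    rw [setIntegral_indicator_mul hΛ hsub]
    have e : ∀ i j, (∫ x in Λ, (rderiv i j ψ x • g i j x) * η x)
        + (1 / 2 : ℂ) * ∫ x in Λ, (rderiv i j (rderiv i j ψ) x • f x) * η x
        = ∫ x in Λ, ((rderiv i j ψ x • g i j x) * η x
          + (1 / 2 : ℂ) * ((rderiv i j (rderiv i j ψ) x • f x) * η x)) := by
      intro i j
      rw [integral_add (Ib i j) ((Ie i j).const_mul _), integral_const_mul]
    simp only [e]
    have I1 : ∀ i j, Integrable (fun x => (rderiv i j ψ x • g i j x) * η x
          + (1 / 2 : ℂ) * ((rderiv i j (rderiv i j ψ) x • f x) * η x)) (volume.restrict Λ) :=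
      fun i j => (Ib i j).add ((Ie i j).const_mul _)
    have e2 : ∀ i, ∑ j, ∫ x in Λ, ((rderiv i j ψ x • g i j x) * η x
          + (1 / 2 : ℂ) * ((rderiv i j (rderiv i j ψ) x • f x) * η x))
        = ∫ x in Λ, ∑ j, ((rderiv i j ψ x • g i j x) * η x
          + (1 / 2 : ℂ) * ((rderiv i j (rderiv i j ψ) x • f x) * η x)) :=
      fun i => (integral_finsetSum _ fun j _ => I1 i j).symm
    simp only [e2]
    rw [← integral_finsetSum _ fun i _ => integrable_finsetSum _ fun j _ => I1 i j]
    have e3 : ∫ x in Λ, h x * (ψ x • η x) = ∫ x in Λ, (ψ x • h x) * η x := by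
      refine integral_congr_ae (ae_of_all _ fun x => ?_)
      simp only [Complex.real_smul]
      ring
    rw [e3, ← integral_sub Ih
      (integrable_finsetSum _ fun i _ => integrable_finsetSum _ fun j _ => I1 i j)]
    refine integral_congr_ae (ae_of_all _ fun x => ?_)
    simp only [commutatorTerm, sub_mul, Finset.sum_mul, add_mul, Complex.real_smul]
    congr 1
    refine Finset.sum_congr rfl fun i _ => Finset.sum_congr rfl fun j _ => ?_
    push_cast
    ring
  rw [w5, w6, ← w1]
  simp only [w3, w4]
  have w7 : ∀ i j, (∫ x in Λ, (rderiv i j ψ x • f x) * pderiv i j η x)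
      = - (∫ x in Λ, (rderiv i j ψ x • g i j x) * η x)
        - (∫ x in Λ, (rderiv i j (rderiv i j ψ) x • f x) * η x) := by
    intro i j
    rw [← w2 i j]; ring
  simp only [w7, Finset.mul_sum, Finset.sum_add_distrib, Finset.sum_sub_distrib,
    Finset.sum_neg_distrib, mul_add, mul_sub, mul_neg]
  simp only [← Finset.mul_sum]
  ring

/-! ### The interior energy estimate -/

lemma re_integral {μ : Measure (Config N d)} {F : Config N d → ℂ} (hF : Integrable F μ) :
    (∫ x, F x ∂μ).re = ∫ x, (F x).re ∂μ :=
  (Complex.reCLM.integral_comp_comm hF).symm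

/-- The function `θ² f` is the admissible test element for the energy estimate. -/
lemma IsH10.smul_smul {Λ : Set (Config N d)} (hΛ : MeasurableSet Λ)
    {f : Config N d → ℂ} {g : Fin N → Fin d → Config N d → ℂ} (h : IsH10 Λ f g)
    {θ : Config N d → ℝ} {B : ℝ} (hθ : IsCutoff θ B) :
    IsH10 Λ (fun x => θ x • θ x • f x)
      (fun i j x => θ x • (θ x • g i j x + rderiv i j θ x • f x)
        + rderiv i j θ x • θ x • f x) := by
  have h1 := (h.smul hΛ subset_rfl hθ.contDiff hθ.le hθ.rderiv_le).congr
    (indicator_ae_eq_restrict hΛ) (fun i j => indicator_ae_eq_restrict hΛ)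
  exact (h1.smul hΛ subset_rfl hθ.contDiff hθ.le hθ.rderiv_le).congr
    (indicator_ae_eq_restrict hΛ) (fun i j => indicator_ae_eq_restrict hΛ)

lemma rderiv_eq_zero {θ : Config N d → ℝ} {S : Set (Config N d)} (hS : tsupport θ ⊆ S)
    {x : Config N d} (hx : x ∉ S) (i : Fin N) (j : Fin d) : rderiv i j θ x = 0 :=
  image_eq_zero_of_notMem_tsupport fun h => hx (hS (tsupport_rderiv_subset θ i j h))

lemma integrable_normSq {μ : Measure (Config N d)} {f : Config N d → ℂ} (hf : MemLp f 2 μ) :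
    Integrable (fun x => ‖f x‖ ^ 2) μ := by
  simpa using hf.integrable_norm_pow (p := 2) (by norm_num)

/-- If `H f = E f` on the support of `θ`, the mean square of `θ ∇f` is bounded by that of `f`. -/
lemma IsWeakSolution.caccioppoli {W : Config N d → ℝ} {B₀ : ℝ} (hW : IsBoundedPotential W B₀)
    {Λ : Set (Config N d)} (hΛ : MeasurableSet Λ)
    {f h : Config N d → ℂ} {g : Fin N → Fin d → Config N d → ℂ} (H : IsWeakSolution W Λ f g h)
    {θ : Config N d → ℝ} {B : ℝ} (hθ : IsCutoff θ B) {S : Set (Config N d)}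
    (hS : MeasurableSet S) (hθS : tsupport θ ⊆ S) {E E₁ : ℝ} (hE : E ≤ E₁) (hE₁ : 0 ≤ E₁)
    (hh : ∀ᵐ x ∂(volume.restrict Λ), x ∈ S → h x = E * f x) :
    ∑ i, ∑ j, ∫ x in Λ, ‖θ x • g i j x‖ ^ 2
      ≤ 4 * (E₁ + N * d) * B ^ 2 * ∫ x in Λ, S.indicator (fun x => ‖f x‖ ^ 2) x := by
  have hB : 0 ≤ B := (abs_nonneg _).trans (hθ.le 0)
  have H2 := (H.isH10.smul_smul hΛ hθ).conj
  have hp := congrArg Complex.re (H.pairing hW H2)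
  have IS : Integrable (S.indicator fun x => ‖f x‖ ^ 2) (volume.restrict Λ) :=
    (integrable_normSq H.isH10.memLp).indicator hS
  set Y := ∫ x in Λ, S.indicator (fun x => ‖f x‖ ^ 2) x with hY
  have hhalf : ∀ z : ℂ, ((1 / 2 : ℂ) * z).re = 1 / 2 * z.re := by
    intro z
    have : (1 / 2 : ℂ) = ((1 / 2 : ℝ) : ℂ) := by push_cast; rfl
    rw [this, Complex.re_ofReal_mul]
  have J : ∀ i j, Integrable (fun x => g i j x * (starRingEnd ℂ) (θ x • (θ x • g i j x
      + rderiv i j θ x • f x) + rderiv i j θ x • θ x • f x)) (volume.restrict Λ) :=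
    fun i j => (H.isH10.memLp_grad i j).integrable_mul (H2.memLp_grad i j)
  have JW : Integrable (fun x => (W x : ℂ) * f x * (starRingEnd ℂ) (θ x • θ x • f x))
      (volume.restrict Λ) := (hW.memLp_mul H.isH10.memLp).integrable_mul H2.memLp
  have Jh : Integrable (fun x => h x * (starRingEnd ℂ) (θ x • θ x • f x))
      (volume.restrict Λ) := H.memLp_rhs.integrable_mul H2.memLp
  rw [Complex.add_re, hhalf, Complex.re_sum, re_integral JW, re_integral Jh] at hp
  simp only [Complex.re_sum] at hp
  have h1 : ∀ i j, 1 / 2 * (∫ x in Λ, ‖θ x • g i j x‖ ^ 2) - 2 * B ^ 2 * Y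
      ≤ (∫ x in Λ, g i j x * (starRingEnd ℂ) (θ x • (θ x • g i j x
        + rderiv i j θ x • f x) + rderiv i j θ x • θ x • f x)).re := by
    intro i j
    have Ig : Integrable (fun x => ‖θ x • g i j x‖ ^ 2) (volume.restrict Λ) :=
      integrable_normSq (memLp_smul_of_bdd hθ.contDiff.continuous hθ.le (H.isH10.memLp_grad i j))
    rw [re_integral (J i j), hY, ← integral_const_mul, ← integral_const_mul,
      ← integral_sub (Ig.const_mul _) (IS.const_mul _)]
    -- The cross term `2 θ ∂θ g f` is absorbed pointwise: half of `θ² |g|²` is given up and `2 (∂θ)²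
    -- |f|²` is paid, by completing a square.
    refine integral_mono ((Ig.const_mul _).sub (IS.const_mul _)) (J i j).re fun x => ?_
    have e1 : (rderiv i j θ x) ^ 2 * ‖f x‖ ^ 2
        ≤ B ^ 2 * S.indicator (fun x => ‖f x‖ ^ 2) x := by
      by_cases hx : x ∈ S
      · rw [Set.indicator_of_mem hx]
        exact mul_le_mul_of_nonneg_right (sq_le_sq' (neg_le_of_abs_le (hθ.rderiv_le i j x))
          (le_of_abs_le (hθ.rderiv_le i j x))) (sq_nonneg _)
      · rw [rderiv_eq_zero hθS hx, Set.indicator_of_notMem hx]; simp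
    have e2 : 1 / 2 * ‖θ x • g i j x‖ ^ 2 - 2 * ((rderiv i j θ x) ^ 2 * ‖f x‖ ^ 2)
        ≤ (g i j x * (starRingEnd ℂ) (θ x • (θ x • g i j x
        + rderiv i j θ x • f x) + rderiv i j θ x • θ x • f x)).re := by
      rw [norm_smul, mul_pow, Real.norm_eq_abs, sq_abs, ← Complex.normSq_eq_norm_sq,
        ← Complex.normSq_eq_norm_sq]
      simp only [Complex.normSq_apply, map_add, Complex.real_smul, map_mul, Complex.conj_ofReal,
        Complex.mul_re, Complex.mul_im, Complex.add_re, Complex.add_im, Complex.conj_re,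
        Complex.conj_im, Complex.ofReal_re, Complex.ofReal_im]
      nlinarith [sq_nonneg (θ x * (g i j x).re + 2 * rderiv i j θ x * (f x).re),
        sq_nonneg (θ x * (g i j x).im + 2 * rderiv i j θ x * (f x).im)]
    refine le_trans ?_ e2
    beta_reduce
    linarith
  -- The potential term is dropped by its sign, so the final constant does not involve `B₀`.
  have h2 : 0 ≤ ∫ x in Λ, ((W x : ℂ) * f x * (starRingEnd ℂ) (θ x • θ x • f x)).re := by
    refine integral_nonneg_of_ae ?_
    filter_upwards [ae_restrict_of_ae hW.nonneg] with x hx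
    have : ((W x : ℂ) * f x * (starRingEnd ℂ) (θ x • θ x • f x)).re
        = W x * (θ x ^ 2 * ‖f x‖ ^ 2) := by
      rw [← Complex.normSq_eq_norm_sq]
      simp only [Complex.normSq_apply, Complex.real_smul, map_mul, Complex.conj_ofReal,
        Complex.mul_re, Complex.mul_im, Complex.conj_re,
        Complex.conj_im, Complex.ofReal_re, Complex.ofReal_im]
      ring
    rw [this]
    exact mul_nonneg hx (by positivity)
  have h3 : ∫ x in Λ, (h x * (starRingEnd ℂ) (θ x • θ x • f x)).re ≤ E₁ * B ^ 2 * Y := by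
    rw [hY, ← integral_const_mul]
    refine integral_mono_ae Jh.re (IS.const_mul _) ?_
    filter_upwards [hh] with x hx
    by_cases hxS : x ∈ S
    · rw [hx hxS, Set.indicator_of_mem hxS]
      have : ((E : ℂ) * f x * (starRingEnd ℂ) (θ x • θ x • f x)).re
          = E * (θ x ^ 2 * ‖f x‖ ^ 2) := by
        rw [← Complex.normSq_eq_norm_sq]
        simp only [Complex.normSq_apply, Complex.real_smul, map_mul, Complex.conj_ofReal,
          Complex.mul_re, Complex.mul_im, Complex.conj_re,
          Complex.conj_im, Complex.ofReal_re, Complex.ofReal_im]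
        ring
      rw [this, mul_assoc]
      have h4 : θ x ^ 2 ≤ B ^ 2 :=
        sq_le_sq' (neg_le_of_abs_le (hθ.le x)) (le_of_abs_le (hθ.le x))
      exact (mul_le_mul_of_nonneg_right hE (by positivity)).trans
        (mul_le_mul_of_nonneg_left (mul_le_mul_of_nonneg_right h4 (sq_nonneg _)) hE₁)
    · have : θ x = 0 := image_eq_zero_of_notMem_tsupport fun h => hxS (hθS h)
      rw [this, Set.indicator_of_notMem hxS]
      simp
  have h5 := Finset.sum_le_sum fun i (_ : i ∈ Finset.univ) =>
    Finset.sum_le_sum fun j (_ : j ∈ Finset.univ) => h1 i j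
  simp only [Finset.sum_sub_distrib, ← Finset.mul_sum, Finset.sum_const, Finset.card_univ,
    Fintype.card_fin, nsmul_eq_mul] at h5
  nlinarith

lemma norm_sum_sum_sq_le (a : Fin N → Fin d → ℂ) :
    ‖∑ i, ∑ j, a i j‖ ^ 2 ≤ N * d * ∑ i, ∑ j, ‖a i j‖ ^ 2 := by
  have h1 : ‖∑ i, ∑ j, a i j‖ ≤ ∑ p : Fin N × Fin d, ‖a p.1 p.2‖ := by
    rw [← Fintype.sum_prod_type']
    exact norm_sum_le _ _
  have h2 := sq_sum_le_card_mul_sum_sq (s := (Finset.univ : Finset (Fin N × Fin d)))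
    (f := fun p => ‖a p.1 p.2‖)
  rw [Finset.card_univ, Fintype.card_prod, Fintype.card_fin, Fintype.card_fin,
    Fintype.sum_prod_type (fun p : Fin N × Fin d => ‖a p.1 p.2‖ ^ 2)] at h2
  push_cast at h2
  exact (pow_le_pow_left₀ (norm_nonneg _) h1 2).trans h2

/-- The commutator term is bounded in mean square by the solution on the support of the cutoff's
gradient. -/
lemma IsWeakSolution.commutatorTerm_le {W : Config N d → ℝ} {B₀ : ℝ}
    (hW : IsBoundedPotential W B₀) {Λ : Set (Config N d)} (hΛ : MeasurableSet Λ)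
    {f h : Config N d → ℂ} {g : Fin N → Fin d → Config N d → ℂ} (H : IsWeakSolution W Λ f g h)
    {ψ θ : Config N d → ℝ} {B : ℝ} (hψ : IsCutoff ψ B) (hθ : IsCutoff θ B)
    {S : Set (Config N d)} (hS : MeasurableSet S) (hθS : tsupport θ ⊆ S)
    (hψθ : ∀ i j, ∀ x ∈ tsupport (rderiv i j ψ), θ x = 1)
    {E E₁ : ℝ} (hE : E ≤ E₁) (hE₁ : 0 ≤ E₁)
    (hh : ∀ᵐ x ∂(volume.restrict Λ), x ∈ S → h x = E * f x) :
    ∫ x in Λ, ‖commutatorTerm ψ f g x‖ ^ 2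
      ≤ N * d * (2 * B ^ 2) * (4 * (E₁ + N * d) * B ^ 2 + N * d)
        * ∫ x in Λ, S.indicator (fun x => ‖f x‖ ^ 2) x := by
  have hB : 0 ≤ B := (abs_nonneg _).trans (hθ.le 0)
  have hc := H.caccioppoli hW hΛ hθ hS hθS hE hE₁ hh
  have IS : Integrable (S.indicator fun x => ‖f x‖ ^ 2) (volume.restrict Λ) :=
    (integrable_normSq H.isH10.memLp).indicator hS
  have Ig : ∀ i j, Integrable (fun x => ‖θ x • g i j x‖ ^ 2) (volume.restrict Λ) := fun i j =>
    integrable_normSq (memLp_smul_of_bdd hθ.contDiff.continuous hθ.le (H.isH10.memLp_grad i j))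
  have I0 : ∀ i j, Integrable (fun x => 2 * B ^ 2 * (‖θ x • g i j x‖ ^ 2
      + S.indicator (fun x => ‖f x‖ ^ 2) x)) (volume.restrict Λ) :=
    fun i j => ((Ig i j).add IS).const_mul _
  have I1 : Integrable (fun x => (N : ℝ) * d * ∑ i : Fin N, ∑ j : Fin d, 2 * B ^ 2 *
      (‖θ x • g i j x‖ ^ 2 + S.indicator (fun x => ‖f x‖ ^ 2) x)) (volume.restrict Λ) :=
    (integrable_finsetSum _ fun i _ => integrable_finsetSum _ fun j _ => I0 i j).const_mul _
  have h1 : ∫ x in Λ, ‖commutatorTerm ψ f g x‖ ^ 2 ≤ ∫ x in Λ, (N : ℝ) * d * ∑ i : Fin N, ∑ j : Fin d,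
      2 * B ^ 2 * (‖θ x • g i j x‖ ^ 2 + S.indicator (fun x => ‖f x‖ ^ 2) x) := by
    refine integral_mono (integrable_normSq (memLp_commutatorTerm hψ H.isH10.memLp
      H.isH10.memLp_grad)) I1 fun x => ?_
    refine (norm_sum_sum_sq_le _).trans (mul_le_mul_of_nonneg_left (Finset.sum_le_sum fun i _ =>
      Finset.sum_le_sum fun j _ => ?_) (by positivity))
    -- Where the derivatives of `ψ` live, `θ = 1`, so the gradient there is controlled by `θ ∇f`.
    by_cases hx : x ∈ tsupport (rderiv i j ψ)
    · have hθ1 := hψθ i j x hx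
      have hxS : x ∈ S := hθS (subset_tsupport θ (by simp [hθ1]))
      rw [hθ1, Set.indicator_of_mem hxS, one_smul]
      have t1 : ‖rderiv i j ψ x • g i j x‖ ≤ B * ‖g i j x‖ := by
        rw [norm_smul]
        exact mul_le_mul_of_nonneg_right (hψ.rderiv_le i j x) (norm_nonneg _)
      have t2 : ‖(1 / 2 : ℝ) • rderiv i j (rderiv i j ψ) x • f x‖ ≤ B * ‖f x‖ := by
        rw [norm_smul, norm_smul]
        have := mul_le_mul_of_nonneg_right (hψ.rderiv_rderiv_le i j x) (norm_nonneg (f x))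
        rw [Real.norm_of_nonneg (by norm_num : (0 : ℝ) ≤ 1 / 2), Real.norm_eq_abs]
        nlinarith [mul_nonneg (abs_nonneg (rderiv i j (rderiv i j ψ) x)) (norm_nonneg (f x))]
      have t3 := (norm_add_le (rderiv i j ψ x • g i j x)
        ((1 / 2 : ℝ) • rderiv i j (rderiv i j ψ) x • f x)).trans (add_le_add t1 t2)
      refine (pow_le_pow_left₀ (norm_nonneg _) t3 2).trans ?_
      nlinarith [sq_nonneg (B * ‖g i j x‖ - B * ‖f x‖)]
    · have e1 : rderiv i j ψ x = 0 := image_eq_zero_of_notMem_tsupport hx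
      have e2 : rderiv i j (rderiv i j ψ) x = 0 := rderiv_eq_zero subset_rfl hx i j
      rw [e1, e2]
      have : 0 ≤ S.indicator (fun x => ‖f x‖ ^ 2) x := Set.indicator_nonneg (fun _ _ => by
        positivity) _
      simp only [zero_smul, smul_zero, add_zero, norm_zero, zero_pow two_ne_zero]
      positivity
  refine h1.trans ?_
  rw [integral_const_mul, integral_finsetSum _ fun i _ => integrable_finsetSum _ fun j _ => I0 i j]
  have e : ∀ i : Fin N, ∫ x in Λ, ∑ j : Fin d, 2 * B ^ 2 * (‖θ x • g i j x‖ ^ 2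
      + S.indicator (fun x => ‖f x‖ ^ 2) x) = ∑ j : Fin d, 2 * B ^ 2 *
        ((∫ x in Λ, ‖θ x • g i j x‖ ^ 2) + ∫ x in Λ, S.indicator (fun x => ‖f x‖ ^ 2) x) := by
    intro i
    rw [integral_finsetSum _ fun j _ => I0 i j]
    refine Finset.sum_congr rfl fun j _ => ?_
    rw [integral_const_mul, integral_add (Ig i j) IS]
  simp only [e]
  simp only [← Finset.mul_sum, Finset.sum_add_distrib, Finset.sum_const, Finset.card_univ,
    Fintype.card_fin, nsmul_eq_mul]
  rw [← mul_assoc, mul_assoc (N * d * (2 * B ^ 2))]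
  refine mul_le_mul_of_nonneg_left ?_ (by positivity)
  rw [add_mul]
  refine add_le_add hc (le_of_eq (by ring))

/-! ### Construction of cutoff functions -/

/-- A product of functions of one coordinate each. -/
def coordProd (k : Fin N × Fin d → ℝ → ℝ) (x : Config N d) : ℝ := ∏ p, k p (x p.1 p.2)

lemma contDiff_coord (p : Fin N × Fin d) : ContDiff ℝ ∞ fun x : Config N d => x p.1 p.2 :=
  contDiff_pi.1 (contDiff_pi.1 contDiff_id p.1) p.2

lemma contDiff_coordProd {k : Fin N × Fin d → ℝ → ℝ} (hk : ∀ p, ContDiff ℝ ∞ (k p)) :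
    ContDiff ℝ ∞ (coordProd k) :=
  contDiff_prod fun p _ => (hk p).comp (contDiff_coord p)

/-- Only one factor depends on the differentiated coordinate. The result is again a coordinate
product, so the formula iterates. Products replace functions of the max-norm, which is not smooth.
-/
lemma rderiv_coordProd {k : Fin N × Fin d → ℝ → ℝ} (hk : ∀ p, Differentiable ℝ (k p))
    (i : Fin N) (j : Fin d) :
    rderiv i j (coordProd k) = coordProd (Function.update k (i, j) (deriv (k (i, j)))) := by
  ext x
  have h1 : ∀ p ∈ (Finset.univ : Finset (Fin N × Fin d)),
      HasFDerivAt (fun x : Config N d => k p (x p.1 p.2))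
        (deriv (k p) (x p.1 p.2) • fderiv ℝ (fun x : Config N d => x p.1 p.2) x) x := fun p _ =>
    ((hk p _).hasDerivAt).comp_hasFDerivAt x
      (((contDiff_coord p).differentiable (by simp)) x).hasFDerivAt
  have h2 : ∀ p : Fin N × Fin d, fderiv ℝ (fun x : Config N d => x p.1 p.2) x (coordVec i j)
      = if p = (i, j) then 1 else 0 := by
    intro p
    have : (fun x : Config N d => x p.1 p.2)
        = ((ContinuousLinearMap.proj p.2 : (Fin d → ℝ) →L[ℝ] ℝ).comp
          (ContinuousLinearMap.proj p.1 : Config N d →L[ℝ] (Fin d → ℝ))) := rfl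
    rw [this, ContinuousLinearMap.fderiv]
    obtain ⟨a, b⟩ := p
    simp only [ContinuousLinearMap.comp_apply, ContinuousLinearMap.proj_apply, coordVec,
      Prod.mk.injEq]
    by_cases ha : a = i
    · subst ha
      by_cases hb : b = j
      · subst hb; simp
      · simp [hb]
    · simp [ha]
  have h3 := (HasFDerivAt.finsetProd h1).fderiv
  rw [rderiv, show coordProd k = fun x => ∏ p, k p (x p.1 p.2) from rfl, h3]
  simp only [sum_apply, smul_apply, h2, smul_eq_mul,
    mul_ite, mul_one, mul_zero, Finset.sum_ite_eq', Finset.mem_univ, if_true]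
  rw [coordProd, ← Finset.mul_prod_erase _ _ (Finset.mem_univ (i, j)), mul_comm]
  congr 1
  · simp
  · refine Finset.prod_congr rfl fun p hp => ?_
    rw [Function.update_of_ne (Finset.ne_of_mem_erase hp)]

lemma abs_coordProd_update_le {k : Fin N × Fin d → ℝ → ℝ} (hk : ∀ p t, |k p t| ≤ 1)
    (q : Fin N × Fin d) {f : ℝ → ℝ} {B : ℝ} (hf : ∀ t, |f t| ≤ B) (x : Config N d) :
    |coordProd (Function.update k q f) x| ≤ B := by
  rw [coordProd, ← Finset.mul_prod_erase _ _ (Finset.mem_univ q), abs_mul, Function.update_self]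
  have h1 : |∏ p ∈ Finset.univ.erase q, Function.update k q f p (x p.1 p.2)| ≤ 1 := by
    rw [Finset.abs_prod]
    refine Finset.prod_le_one (fun _ _ => abs_nonneg _) fun p hp => ?_
    rw [Function.update_of_ne (Finset.ne_of_mem_erase hp)]
    exact hk _ _
  exact (mul_le_of_le_one_right (abs_nonneg _) h1).trans (hf _)

lemma isCutoff_coordProd {k : Fin N × Fin d → ℝ → ℝ} {B : ℝ} (hB : 1 ≤ B)
    (hk : ∀ p, ContDiff ℝ ∞ (k p)) (h0 : ∀ p t, |k p t| ≤ 1) (h1 : ∀ p t, |deriv (k p) t| ≤ B)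
    (h2 : ∀ p t, |deriv (deriv (k p)) t| ≤ B) : IsCutoff (coordProd k) B := by
  have hd : ∀ p, ContDiff ℝ ∞ (deriv (k p)) := fun p =>
    (contDiff_infty_iff_deriv.1 (hk p)).2
  refine ⟨contDiff_coordProd hk, fun x => ?_, fun i j x => ?_, fun i j x => ?_⟩
  · refine le_trans ?_ hB
    rw [coordProd, Finset.abs_prod]
    exact Finset.prod_le_one (fun _ _ => abs_nonneg _) fun p _ => h0 _ _
  · rw [rderiv_coordProd fun p => (hk p).differentiable (by simp)]
    exact abs_coordProd_update_le h0 _ (h1 _) x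
  · rw [rderiv_coordProd fun p => (hk p).differentiable (by simp), rderiv_coordProd,
      Function.update_idem, Function.update_self]
    · exact abs_coordProd_update_le h0 _ (h2 _) x
    · intro p
      by_cases hp : p = (i, j)
      · subst hp
        rw [Function.update_self]
        exact (hd _).differentiable (by simp)
      · rw [Function.update_of_ne hp]
        exact (hk _).differentiable (by simp)

lemma IsCutoff.sub {ψ θ : Config N d → ℝ} {B : ℝ} (h : IsCutoff ψ B) (h' : IsCutoff θ B) :
    IsCutoff (fun x => ψ x - θ x) (2 * B) := by
  have key : ∀ {φ₁ φ₂ : Config N d → ℝ}, ContDiff ℝ ∞ φ₁ → ContDiff ℝ ∞ φ₂ → ∀ i j,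
      rderiv i j (fun x => φ₁ x - φ₂ x) = fun x => rderiv i j φ₁ x - rderiv i j φ₂ x := by
    intro φ₁ φ₂ h1 h2 i j
    ext x
    rw [rderiv, fderiv_fun_sub (h1.differentiable (by simp) x) (h2.differentiable (by simp) x)]
    rfl
  refine ⟨h.contDiff.sub h'.contDiff, fun x => ?_, fun i j x => ?_, fun i j x => ?_⟩
  · exact (abs_sub _ _).trans (by linarith [h.le x, h'.le x])
  · rw [key h.contDiff h'.contDiff]
    exact (abs_sub _ _).trans (by linarith [h.rderiv_le i j x, h'.rderiv_le i j x])
  · rw [key h.contDiff h'.contDiff,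
      key (contDiff_rderiv h.contDiff i j) (contDiff_rderiv h'.contDiff i j)]
    exact (abs_sub _ _).trans (by linarith [h.rderiv_rderiv_le i j x, h'.rderiv_rderiv_le i j x])

lemma IsCutoff.mono {ψ : Config N d → ℝ} {B B' : ℝ} (h : IsCutoff ψ B) (hB : B ≤ B') :
    IsCutoff ψ B' :=
  ⟨h.contDiff, fun x => (h.le x).trans hB, fun i j x => (h.rderiv_le i j x).trans hB,
    fun i j x => (h.rderiv_rderiv_le i j x).trans hB⟩

/-- A smooth step from `0` to `1` on `[-1/8, 1/8]`. -/
def smoothStep (t : ℝ) : ℝ := Real.smoothTransition (4 * t + 1 / 2)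

lemma contDiff_smoothStep : ContDiff ℝ ∞ smoothStep :=
  Real.smoothTransition.contDiff.comp ((contDiff_const.mul contDiff_id).add contDiff_const)

lemma smoothStep_eq_zero {t : ℝ} (h : t ≤ -(1 / 8)) : smoothStep t = 0 :=
  Real.smoothTransition.zero_of_nonpos (by linarith)

lemma smoothStep_eq_one {t : ℝ} (h : 1 / 8 ≤ t) : smoothStep t = 1 :=
  Real.smoothTransition.one_of_one_le (by linarith)

lemma smoothStep_nonneg (t : ℝ) : 0 ≤ smoothStep t := Real.smoothTransition.nonneg _

lemma smoothStep_le_one (t : ℝ) : smoothStep t ≤ 1 := Real.smoothTransition.le_one _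

lemma contDiff_deriv_smoothStep : ContDiff ℝ ∞ (deriv smoothStep) :=
  (contDiff_infty_iff_deriv.1 contDiff_smoothStep).2

lemma hasCompactSupport_deriv_smoothStep : HasCompactSupport (deriv smoothStep) := by
  refine HasCompactSupport.intro (isCompact_Icc (a := (-(1 / 8) : ℝ)) (b := 1 / 8)) fun t ht => ?_
  rw [Set.mem_Icc, not_and_or, not_le, not_le] at ht
  rcases ht with ht | ht
  · have : smoothStep =ᶠ[𝓝 t] fun _ => 0 := by
      filter_upwards [Iio_mem_nhds ht] with s hs
      exact smoothStep_eq_zero (le_of_lt hs)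
    rw [this.deriv_eq, deriv_const]
  · have : smoothStep =ᶠ[𝓝 t] fun _ => 1 := by
      filter_upwards [Ioi_mem_nhds ht] with s hs
      exact smoothStep_eq_one (le_of_lt hs)
    rw [this.deriv_eq, deriv_const]

lemma exists_smoothStep_bound : ∃ B : ℝ, 1 ≤ B ∧ (∀ t, |deriv smoothStep t| ≤ B) ∧
    ∀ t, |deriv (deriv smoothStep) t| ≤ B := by
  obtain ⟨B₁, h1⟩ := hasCompactSupport_deriv_smoothStep.exists_bound_of_continuous
    contDiff_deriv_smoothStep.continuous
  obtain ⟨B₂, h2⟩ := hasCompactSupport_deriv_smoothStep.deriv.exists_bound_of_continuous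
    (contDiff_infty_iff_deriv.1 contDiff_deriv_smoothStep).2.continuous
  exact ⟨max 1 (max B₁ B₂), le_max_left _ _,
    fun t => (h1 t).trans ((le_max_left _ _).trans (le_max_right _ _)),
    fun t => (h2 t).trans ((le_max_right _ _).trans (le_max_right _ _))⟩


/-- A smooth approximation of the indicator function of `[c - ρ, c + ρ]`. -/
def smoothBump (ρ c t : ℝ) : ℝ := smoothStep (t + (ρ - c)) + smoothStep (c + ρ - t) - 1

lemma contDiff_smoothBump (ρ c : ℝ) : ContDiff ℝ ∞ (smoothBump ρ c) :=
  ((contDiff_smoothStep.comp (contDiff_id.add contDiff_const)).add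
    (contDiff_smoothStep.comp (contDiff_const.sub contDiff_id))).sub contDiff_const

/-- The sign `σ` makes this form stable under differentiation: `σ = 1` serves the bump and `σ = -1`
its derivative. -/
lemma deriv_add_sub_comp {F : ℝ → ℝ} (hF : Differentiable ℝ F) (σ a b e : ℝ) :
    deriv (fun t => F (t + a) + σ * F (b - t) - e)
      = fun t => deriv F (t + a) - σ * deriv F (b - t) := by
  ext t
  have h1 : HasDerivAt (fun t => F (t + a)) (deriv F (t + a)) t :=
    (hF (t + a)).hasDerivAt.comp_add_const t a
  have h2 : HasDerivAt (fun t => F (b - t)) (-deriv F (b - t)) t :=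
    (hF (b - t)).hasDerivAt.comp_const_sub b t
  rw [((h1.fun_add (h2.const_mul σ)).sub_const e).deriv]
  ring

lemma deriv_smoothBump (ρ c : ℝ) : deriv (smoothBump ρ c)
    = fun t => deriv smoothStep (t + (ρ - c)) + (-1) * deriv smoothStep (c + ρ - t) - 0 := by
  have := deriv_add_sub_comp (contDiff_smoothStep.differentiable (by simp)) 1 (ρ - c) (c + ρ) 1
  simp only [one_mul] at this
  rw [show smoothBump ρ c = fun t => smoothStep (t + (ρ - c)) + smoothStep (c + ρ - t) - 1 from rfl,
    this]
  ext t; ring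

lemma deriv_deriv_smoothBump (ρ c : ℝ) : deriv (deriv (smoothBump ρ c))
    = fun t => deriv (deriv smoothStep) (t + (ρ - c))
      - (-1) * deriv (deriv smoothStep) (c + ρ - t) := by
  rw [deriv_smoothBump,
    deriv_add_sub_comp (contDiff_deriv_smoothStep.differentiable (by simp)) (-1) (ρ - c) (c + ρ) 0]

lemma abs_smoothBump_le (ρ c t : ℝ) : |smoothBump ρ c t| ≤ 1 := by
  have a := smoothStep_nonneg (t + (ρ - c))
  have a' := smoothStep_le_one (t + (ρ - c))
  have b := smoothStep_nonneg (c + ρ - t)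
  have b' := smoothStep_le_one (c + ρ - t)
  rw [smoothBump, abs_le]
  constructor <;> linarith

lemma smoothBump_eq_one {ρ c t : ℝ} (h : |t - c| ≤ ρ - 1 / 8) : smoothBump ρ c t = 1 := by
  rw [abs_le] at h
  rw [smoothBump, smoothStep_eq_one (by linarith), smoothStep_eq_one (by linarith)]
  norm_num

lemma smoothBump_eq_zero {ρ c t : ℝ} (hρ : 1 / 8 ≤ ρ) (h : ρ + 1 / 8 ≤ |t - c|) :
    smoothBump ρ c t = 0 := by
  rcases le_abs'.1 h with h | h
  · rw [smoothBump, smoothStep_eq_zero (by linarith), smoothStep_eq_one (by linarith)]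
    norm_num
  · rw [smoothBump, smoothStep_eq_one (by linarith), smoothStep_eq_zero (by linarith)]
    norm_num

/-- A smooth approximation of the indicator function of the cube of radius `ρ` centred at `u`. -/
def cubeBump (ρ : ℝ) (u : Config N d) : Config N d → ℝ :=
  coordProd fun p => smoothBump ρ (u p.1 p.2)

lemma abs_coord_le_norm (x : Config N d) (i : Fin N) (j : Fin d) : |x i j| ≤ ‖x‖ :=
  (norm_le_pi_norm (x i) j).trans (norm_le_pi_norm x i)

lemma cubeBump_eq_one {ρ : ℝ} {u x : Config N d} (h : ‖x - u‖ ≤ ρ - 1 / 8) :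
    cubeBump ρ u x = 1 :=
  Finset.prod_eq_one fun p _ =>
    smoothBump_eq_one ((abs_coord_le_norm (x - u) p.1 p.2).trans h)

lemma norm_lt_of_forall_coord {x : Config N d} {r : ℝ} (hr : 0 < r) (h : ∀ i j, |x i j| < r) :
    ‖x‖ < r :=
  (pi_norm_lt_iff hr).2 fun i => (pi_norm_lt_iff hr).2 fun j => h i j

lemma norm_le_of_forall_coord {x : Config N d} {r : ℝ} (hr : 0 ≤ r) (h : ∀ i j, |x i j| ≤ r) :
    ‖x‖ ≤ r :=
  (pi_norm_le_iff_of_nonneg hr).2 fun i => (pi_norm_le_iff_of_nonneg hr).2 fun j => h i j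

lemma cubeBump_eq_zero {ρ : ℝ} (hρ : 1 / 8 ≤ ρ) {u x : Config N d} (h : ρ + 1 / 8 ≤ ‖x - u‖) :
    cubeBump ρ u x = 0 := by
  by_contra h0
  refine absurd h (not_le.2 (norm_lt_of_forall_coord (by linarith) fun i j => ?_))
  by_contra h1
  exact h0 (Finset.prod_eq_zero (Finset.mem_univ (i, j)) (smoothBump_eq_zero hρ (not_lt.1 h1)))

lemma tsupport_cubeBump_subset {ρ : ℝ} (hρ : 1 / 8 ≤ ρ) (u : Config N d) :
    tsupport (cubeBump ρ u) ⊆ {x | ‖x - u‖ ≤ ρ + 1 / 8} := by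
  refine closure_minimal (fun x hx => ?_) (isClosed_le (by fun_prop) continuous_const)
  by_contra h
  exact hx (cubeBump_eq_zero hρ (le_of_lt (not_le.1 h)))

lemma isClosed_shell (a b : ℝ) (u : Config N d) :
    IsClosed {x : Config N d | a ≤ ‖x - u‖ ∧ ‖x - u‖ ≤ b} := by
  have h1 : IsClosed {x : Config N d | a ≤ ‖x - u‖} := isClosed_le continuous_const (by fun_prop)
  have h2 : IsClosed {x : Config N d | ‖x - u‖ ≤ b} := isClosed_le (by fun_prop) continuous_const
  exact h1.inter h2

lemma tsupport_rderiv_cubeBump_subset {ρ : ℝ} (hρ : 1 / 8 ≤ ρ) (u : Config N d) (i : Fin N)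
    (j : Fin d) : tsupport (rderiv i j (cubeBump ρ u))
      ⊆ {x | ρ - 1 / 8 ≤ ‖x - u‖ ∧ ‖x - u‖ ≤ ρ + 1 / 8} := by
  refine closure_minimal (fun x hx => ⟨?_, ?_⟩) (isClosed_shell _ _ _)
  · by_contra h
    have : cubeBump ρ u =ᶠ[𝓝 x] fun _ => 1 := by
      filter_upwards [(isOpen_lt (f := fun x : Config N d => ‖x - u‖) (by fun_prop)
        continuous_const).mem_nhds (not_le.1 h)] with y hy
      exact cubeBump_eq_one (le_of_lt hy)
    refine hx ?_
    rw [rderiv, this.fderiv_eq, fderiv_const_apply]; rfl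
  · exact tsupport_cubeBump_subset hρ u (tsupport_rderiv_subset _ i j (subset_tsupport _ hx))

/-- Centre and radius enter only through translates and reflections of one fixed step, so the bound
is uniform in both. -/
lemma exists_isCutoff_cubeBump (N d : ℕ) : ∃ B : ℝ, 0 ≤ B ∧ ∀ (u : Config N d) (ρ : ℝ),
    1 / 8 ≤ ρ → IsCutoff (cubeBump ρ u) B := by
  obtain ⟨B, h1, hB, hB'⟩ := exists_smoothStep_bound
  refine ⟨2 * B, by linarith, fun u ρ hρ => isCutoff_coordProd (by linarith)
    (fun p => contDiff_smoothBump _ _) (fun p t => abs_smoothBump_le _ _ _) (fun p t => ?_)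
    (fun p t => ?_)⟩
  · rw [deriv_smoothBump]
    have a := abs_le.1 (hB (t + (ρ - u p.1 p.2)))
    have b := abs_le.1 (hB (u p.1 p.2 + ρ - t))
    rw [abs_le]; constructor <;> linarith
  · rw [deriv_deriv_smoothBump]
    have a := abs_le.1 (hB' (t + (ρ - u p.1 p.2)))
    have b := abs_le.1 (hB' (u p.1 p.2 + ρ - t))
    rw [abs_le]; constructor <;> linarith

/-- A cutoff function for the cube of radius `r`, together with a cutoff function for its belt. -/
lemma exists_cutoffs (N d : ℕ) : ∃ B : ℝ, ∀ (u : Config N d) (r : ℝ), 1 ≤ r →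
    ∃ ψ θ : Config N d → ℝ, IsCutoff ψ B ∧ IsCutoff θ B ∧
      (∀ x, ‖x - u‖ ≤ r - 1 / 2 → ψ x = 1) ∧
      tsupport ψ ⊆ {x | ‖x - u‖ < r + 1 / 2} ∧
      tsupport θ ⊆ {x | r - 1 / 2 < ‖x - u‖ ∧ ‖x - u‖ < r + 1 / 2} ∧
      ∀ i j, ∀ x ∈ tsupport (rderiv i j ψ), θ x = 1 := by
  obtain ⟨B, hB0, hB⟩ := exists_isCutoff_cubeBump N d
  refine ⟨2 * B, fun u r hr => ⟨cubeBump r u,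
    -- The gradient of `cubeBump r u` lives at distances within `1/8` of `r`. This difference equals
    -- `1` there and vanishes beyond `3/8`, hence outside the open belt.
    fun x => cubeBump (r + 1 / 4) u x - cubeBump (r - 1 / 4) u x,
    (hB u r (by linarith)).mono (by linarith),
    (hB u _ (by linarith)).sub (hB u _ (by linarith)),
    fun x hx => cubeBump_eq_one (by linarith), fun x hx => ?_, ?_, fun i j x hx => ?_⟩⟩
  · have := tsupport_cubeBump_subset (by linarith) u hx
    simp only [Set.mem_ofPred_eq] at this ⊢
    linarith
  · have h1 : tsupport (fun x => cubeBump (r + 1 / 4) u x - cubeBump (r - 1 / 4) u x)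
        ⊆ {x | r - 3 / 8 ≤ ‖x - u‖ ∧ ‖x - u‖ ≤ r + 3 / 8} := by
      refine closure_minimal (fun x hx => ⟨?_, ?_⟩) (isClosed_shell _ _ _)
      · by_contra h
        refine hx ?_
        simp only [not_le] at h
        simp only [cubeBump_eq_one (show ‖x - u‖ ≤ r + 1 / 4 - 1 / 8 by linarith),
          cubeBump_eq_one (show ‖x - u‖ ≤ r - 1 / 4 - 1 / 8 by linarith), sub_self]
      · by_contra h
        refine hx ?_
        simp only [not_le] at h
        simp only [cubeBump_eq_zero (show 1 / 8 ≤ r + 1 / 4 by linarith)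
          (show r + 1 / 4 + 1 / 8 ≤ ‖x - u‖ by linarith),
          cubeBump_eq_zero (show 1 / 8 ≤ r - 1 / 4 by linarith)
          (show r - 1 / 4 + 1 / 8 ≤ ‖x - u‖ by linarith), sub_self]
    intro x hx
    have := h1 hx
    simp only [Set.mem_ofPred_eq] at this ⊢
    constructor <;> linarith [this.1, this.2]
  · have := tsupport_rderiv_cubeBump_subset (by linarith) u i j hx
    simp only [Set.mem_ofPred_eq] at this
    simp only [cubeBump_eq_one (show ‖x - u‖ ≤ r + 1 / 4 - 1 / 8 by linarith [this.2]),
      cubeBump_eq_zero (show 1 / 8 ≤ r - 1 / 4 by linarith)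
          (show r - 1 / 4 + 1 / 8 ≤ ‖x - u‖ by linarith [this.1]), sub_zero]

/-! ### Multiplication by indicator functions -/

lemma coeFn_indicatorOp (Λ S : Set (Config N d)) (hS : MeasurableSet S) (f : L2 Λ) :
    indicatorOp Λ S hS f =ᵐ[volume.restrict Λ] S.indicator f := by
  rw [indicatorOp, LinearMap.mkContinuous_apply]
  have hf : MemLp (S.indicator f) 2 (volume.restrict Λ) := (Lp.memLp f).indicator hS
  have h : indicatorLin Λ S hS f = hf.toLp := rfl
  rw [h]
  exact hf.coeFn_toLp

lemma norm_indicatorOp_apply_le (Λ S : Set (Config N d)) (hS : MeasurableSet S) (f : L2 Λ) :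
    ‖indicatorOp Λ S hS f‖ ≤ ‖f‖ := by
  rw [indicatorOp, LinearMap.mkContinuous_apply]
  simpa using norm_indicatorLin_le Λ S hS f

lemma norm_indicatorOp_le (Λ S : Set (Config N d)) (hS : MeasurableSet S) :
    ‖indicatorOp Λ S hS‖ ≤ 1 :=
  LinearMap.mkContinuous_norm_le _ zero_le_one _

lemma norm_sq_eq_integral {Λ : Set (Config N d)} (f : L2 Λ) :
    ‖f‖ ^ 2 = ∫ x in Λ, ‖f x‖ ^ 2 := by
  have h := inner_self_eq_norm_sq_to_K (𝕜 := ℂ) f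
  rw [L2.inner_def] at h
  simp only [inner_self_eq_norm_sq_to_K] at h
  have h2 : ∫ x in Λ, ((‖f x‖ : ℂ)) ^ 2 = ((∫ x in Λ, ‖f x‖ ^ 2 : ℝ) : ℂ) := by
    rw [← integral_complex_ofReal]
    simp
  have h3 : ((∫ x in Λ, ‖f x‖ ^ 2 : ℝ) : ℂ) = ((‖f‖ ^ 2 : ℝ) : ℂ) := by
    rw [← h2]; push_cast; exact h
  exact (Complex.ofReal_inj.1 h3).symm

lemma norm_sq_indicatorOp {Λ S : Set (Config N d)} (hS : MeasurableSet S) (f : L2 Λ) :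
    ‖indicatorOp Λ S hS f‖ ^ 2 = ∫ x in Λ, S.indicator (fun x => ‖f x‖ ^ 2) x := by
  rw [norm_sq_eq_integral]
  refine integral_congr_ae ?_
  filter_upwards [coeFn_indicatorOp Λ S hS f] with x hx
  rw [hx]
  by_cases h : x ∈ S <;> simp [h]

lemma isSelfAdjoint_indicatorOp (Λ S : Set (Config N d)) (hS : MeasurableSet S) :
    IsSelfAdjoint (indicatorOp Λ S hS) := by
  rw [ContinuousLinearMap.isSelfAdjoint_iff_isSymmetric]
  intro f g
  simp only [ContinuousLinearMap.coe_coe]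
  rw [L2.inner_def, L2.inner_def]
  refine integral_congr_ae ?_
  filter_upwards [coeFn_indicatorOp Λ S hS f, coeFn_indicatorOp Λ S hS g] with x h1 h2
  rw [h1, h2]
  by_cases h : x ∈ S <;> simp [h]

lemma indicatorOp_eq_self {Λ S : Set (Config N d)} (hS : MeasurableSet S) {f : L2 Λ}
    (h : ∀ᵐ x ∂(volume.restrict Λ), x ∉ S → f x = 0) : indicatorOp Λ S hS f = f := by
  refine Lp.ext ?_
  filter_upwards [coeFn_indicatorOp Λ S hS f, h] with x h1 h2
  rw [h1]
  by_cases hx : x ∈ S <;> simp [hx, h2]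

lemma indicatorOp_eq_zero {Λ S : Set (Config N d)} (hS : MeasurableSet S) {f : L2 Λ}
    (h : ∀ᵐ x ∂(volume.restrict Λ), x ∈ S → f x = 0) : indicatorOp Λ S hS f = 0 := by
  refine Lp.ext ?_
  filter_upwards [coeFn_indicatorOp Λ S hS f, h, Lp.coeFn_zero ℂ 2 (volume.restrict Λ)]
    with x h1 h2 h3
  rw [h1, h3]
  by_cases hx : x ∈ S <;> simp [hx, h2]

/-- The norm of `1_T G 1_S`. -/
def offDiag {Λ : Set (Config N d)} (G : L2 Λ →L[ℂ] L2 Λ) (T S : Set (Config N d))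
    (hT : MeasurableSet T) (hS : MeasurableSet S) : ℝ :=
  ‖(indicatorOp Λ T hT).comp (G.comp (indicatorOp Λ S hS))‖

lemma offDiag_nonneg {Λ : Set (Config N d)} (G : L2 Λ →L[ℂ] L2 Λ) {T S : Set (Config N d)}
    (hT : MeasurableSet T) (hS : MeasurableSet S) : 0 ≤ offDiag G T S hT hS := norm_nonneg _

lemma offDiag_le_norm {Λ : Set (Config N d)} (G : L2 Λ →L[ℂ] L2 Λ) {T S : Set (Config N d)}
    (hT : MeasurableSet T) (hS : MeasurableSet S) : offDiag G T S hT hS ≤ ‖G‖ := by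
  refine (ContinuousLinearMap.opNorm_comp_le _ _).trans ?_
  refine (mul_le_of_le_one_left (norm_nonneg _) (norm_indicatorOp_le _ _ _)).trans ?_
  refine (ContinuousLinearMap.opNorm_comp_le _ _).trans ?_
  exact mul_le_of_le_one_right (norm_nonneg _) (norm_indicatorOp_le _ _ _)

/-- Source and target exchange roles under the adjoint. This lets a walk start at the middle of a
shell and run inwards as well as outwards. -/
lemma offDiag_comm {Λ : Set (Config N d)} {G : L2 Λ →L[ℂ] L2 Λ} (hG : IsSelfAdjoint G)
    {T S : Set (Config N d)} (hT : MeasurableSet T) (hS : MeasurableSet S) :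
    offDiag G T S hT hS = offDiag G S T hS hT := by
  rw [offDiag, offDiag, ← norm_star]
  congr 1
  rw [ContinuousLinearMap.star_eq_adjoint, ContinuousLinearMap.adjoint_comp,
    ContinuousLinearMap.adjoint_comp, hG.adjoint_eq,
    (isSelfAdjoint_indicatorOp Λ T hT).adjoint_eq, (isSelfAdjoint_indicatorOp Λ S hS).adjoint_eq,
    ContinuousLinearMap.comp_assoc]

lemma norm_le_offDiag_mul {Λ : Set (Config N d)} (G : L2 Λ →L[ℂ] L2 Λ) {T S : Set (Config N d)}
    (hT : MeasurableSet T) (hS : MeasurableSet S) (f : L2 Λ) :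
    ‖indicatorOp Λ T hT (G (indicatorOp Λ S hS f))‖ ≤ offDiag G T S hT hS * ‖f‖ :=
  ((indicatorOp Λ T hT).comp (G.comp (indicatorOp Λ S hS))).le_opNorm f

/-! ### Geometric resolvent inequalities -/

lemma measurableSet_cube (u : Lattice N d) (L : ℕ) : MeasurableSet (cube u L) := by
  have h : Measurable fun x : Config N d => ‖x - u.toConfig‖ := by fun_prop
  exact measurableSet_lt h measurable_const

/-- `C` is a constant for the geometric resolvent inequality below the energy `E₁`: the resolvent
in `Λ` applied to a source `s` in the interior of a cube decays from the cube outwards at least as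
the solution `f'` of the same equation in a subset `Λ'` of `Λ`. -/
def IsCutConstant (N d : ℕ) (E₁ C : ℝ) : Prop :=
  ∀ (W : Config N d → ℝ) (B₀ : ℝ), IsBoundedPotential W B₀ → ∀ E : ℝ, E ≤ E₁ →
    ∀ Λ' Λ : Set (Config N d), MeasurableSet Λ' → MeasurableSet Λ → Λ' ⊆ Λ →
    ∀ (w : Lattice N d) (r : ℕ), 1 ≤ r →
    (∀ x ∈ Λ, ‖x - w.toConfig‖ < r + 1 / 2 → x ∈ Λ') →
    ∀ G : L2 Λ →L[ℂ] L2 Λ, IsResolvent W Λ (E : ℂ) G →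
    ∀ (s : L2 Λ) (s' f' : L2 Λ'), HamiltonianGraph W Λ' f' (s' + (E : ℂ) • f') →
    s' =ᵐ[volume.restrict Λ'] s →
    (∀ᵐ x ∂(volume.restrict Λ), ¬ ‖x - w.toConfig‖ ≤ r - 1 / 2 → s x = 0) →
    ∀ (T : Set (Config N d)) (hT : MeasurableSet T), (∀ x ∈ T, (r : ℝ) + 1 / 2 ≤ ‖x - w.toConfig‖) →
    ‖indicatorOp Λ T hT (G s)‖ ≤ C * offDiag G T (belt w r) hT (measurableSet_belt w r)
      * ‖indicatorOp Λ' (belt w r) (measurableSet_belt w r) f'‖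

lemma ae_restrict_of_subset_of_ae {Λ Λ' : Set (Config N d)} (hsub : Λ' ⊆ Λ) {p : Config N d → Prop}
    (h : ∀ᵐ x ∂(volume.restrict Λ), p x) : ∀ᵐ x ∂(volume.restrict Λ'), p x :=
  ae_mono (Measure.restrict_mono hsub le_rfl) h

/-- With `F = ψ f'` extended by zero and `c` the commutator term, `F` solves the equation in `Λ`
with source `s - c`, that is, `G s = F + G c`. On `T` the function `F` vanishes, and `c` lives in
the belt, where it is bounded by `f'`. -/
lemma exists_isCutConstant (N d : ℕ) (E₁ : ℝ) : ∃ C, 1 ≤ C ∧ IsCutConstant N d E₁ C := by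
  obtain ⟨B, hB⟩ := exists_cutoffs N d
  set D : ℝ := N * d * (2 * B ^ 2) * (4 * (max E₁ 0 + N * d) * B ^ 2 + N * d) with hD
  have hD0 : 0 ≤ D := by positivity
  -- The mean-square bound gives `√D`; the larger `1 + D` also secures `1 ≤ C`.
  refine ⟨1 + D, by linarith, ?_⟩
  intro W B₀ hW E hE Λ' Λ hΛ' hΛ hsub w r hr hball G hG s s' f' hf' hss' hs T hT hTw
  obtain ⟨ψ, θ, hψ, hθ, hψ1, hψs, hθs, hψθ⟩ := hB w.toConfig r (by exact_mod_cast hr)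
  obtain ⟨g, hg⟩ := hf'.exists_isWeakSolution
  have hψs' : tsupport ψ ∩ Λ ⊆ Λ' := fun x hx => hball x hx.2 (hψs hx.1)
  have hrhs := Lp.coeFn_add s' ((E : ℂ) • f')
  have hsm := Lp.coeFn_smul (E : ℂ) f'
  have hs' := ae_restrict_of_subset_of_ae hsub hs
  -- The source vanishes on the belt, so `f'` solves the homogeneous equation there, as the energy
  -- estimate requires.
  have hh : ∀ᵐ x ∂(volume.restrict Λ'), x ∈ belt w r →
      (s' + (E : ℂ) • f' : L2 Λ') x = E * f' x := by
    filter_upwards [hrhs, hsm, hss', hs'] with x h1 h2 h3 h4 hx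
    rw [h1, Pi.add_apply, h2, Pi.smul_apply, h3, h4 (not_le.2 hx.1), zero_add, smul_eq_mul]
  have hcomm := hg.commutatorTerm_le hW hΛ' hψ hθ (measurableSet_belt w r) hθs hψθ
    (hE.trans (le_max_left E₁ 0)) (le_max_right _ _) hh
  rw [← hD, ← norm_sq_indicatorOp (measurableSet_belt w r)] at hcomm
  have hw := hg.smul hΛ' hsub hψ hψs'
  set c₀ := commutatorTerm ψ f' g with hc₀
  have mc₀ : MemLp c₀ 2 (volume.restrict Λ') :=
    memLp_commutatorTerm hψ hg.isH10.memLp hg.isH10.memLp_grad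
  have mc : MemLp (Λ'.indicator c₀) 2 (volume.restrict Λ) := memLp_indicator_of_subset hΛ' hsub mc₀
  set c : L2 Λ := mc.toLp with hc
  set F : L2 Λ := hw.isH10.memLp.toLp with hF
  have cF : F =ᵐ[volume.restrict Λ] _ := hw.isH10.memLp.coeFn_toLp
  have cc : c =ᵐ[volume.restrict Λ] _ := mc.coeFn_toLp
  have key : HamiltonianGraph W Λ F (s - c + (E : ℂ) • F) := by
    refine hw.hamiltonianGraph cF.symm ?_
    have a1 : ∀ᵐ x ∂(volume.restrict Λ), x ∈ Λ' →
        (s' + (E : ℂ) • f' : L2 Λ') x = s x + E * f' x := by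
      have : ∀ᵐ x ∂(volume.restrict Λ'), (s' + (E : ℂ) • f' : L2 Λ') x = s x + E * f' x := by
        filter_upwards [hrhs, hsm, hss'] with x h1 h2 h3
        rw [h1, Pi.add_apply, h2, Pi.smul_apply, h3, smul_eq_mul]
      have h2 := (ae_restrict_iff' hΛ').1 this
      exact ae_restrict_of_ae h2
    filter_upwards [a1, hs, cF, cc, Lp.coeFn_add (s - c) ((E : ℂ) • F), Lp.coeFn_sub s c,
      Lp.coeFn_smul (E : ℂ) F, ae_restrict_mem (μ := volume) hΛ]
      with x h1 h2 h3 h4 h5 h6 h7 h8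
    rw [h5, Pi.add_apply, h6, Pi.sub_apply, h7, Pi.smul_apply, h3, h4]
    by_cases hx : x ∈ Λ'
    · rw [Set.indicator_of_mem hx, Set.indicator_of_mem hx, Set.indicator_of_mem hx, h1 hx]
      -- Here `ψ s = s`: either `ψ = 1` or `s` vanishes.
      by_cases hx2 : ‖x - w.toConfig‖ ≤ r - 1 / 2
      · rw [hψ1 x hx2]; simp only [one_smul, smul_eq_mul]; ring
      · rw [h2 hx2]; simp only [Complex.real_smul, smul_eq_mul]; ring
    · have : s x = 0 := h2 fun h => hx (hball x h8 (by linarith))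
      simp [hx, this]
  have e1 : G s - G c = F := by
    have := hG.2 _ _ key
    rwa [add_sub_cancel_right, map_sub] at this
  have e2 : indicatorOp Λ T hT F = 0 := by
    refine indicatorOp_eq_zero hT ?_
    filter_upwards [cF] with x h1 hx
    rw [h1]
    have : ψ x = 0 := image_eq_zero_of_notMem_tsupport fun h =>
      absurd (hψs h) (not_lt.2 (hTw x hx))
    by_cases hx : x ∈ Λ' <;> simp [hx, this]
  have e3 : indicatorOp Λ (belt w r) (measurableSet_belt w r) c = c := by
    refine indicatorOp_eq_self _ ?_
    filter_upwards [cc] with x h1 hx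
    rw [h1]
    have : c₀ x = 0 := by
      refine Finset.sum_eq_zero fun i _ => Finset.sum_eq_zero fun j _ => ?_
      have hn : x ∉ tsupport (rderiv i j ψ) := fun h =>
        hx (hθs (subset_tsupport θ (by simp [hψθ i j x h])))
      have e1 : rderiv i j ψ x = 0 := image_eq_zero_of_notMem_tsupport hn
      have e2 : rderiv i j (rderiv i j ψ) x = 0 :=
        image_eq_zero_of_notMem_tsupport fun h => hn (tsupport_rderiv_subset _ i j h)
      rw [e1, e2]; simp
    by_cases hx : x ∈ Λ' <;> simp [hx, this]
  have e4 : ‖c‖ ≤ (1 + D) * ‖indicatorOp Λ' (belt w r) (measurableSet_belt w r) f'‖ := by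
    refine (pow_le_pow_iff_left₀ (norm_nonneg _) (by positivity) two_ne_zero).1 ?_
    have : ‖c‖ ^ 2 = ∫ x in Λ', ‖c₀ x‖ ^ 2 := by
      rw [norm_sq_eq_integral]
      have : ∫ x in Λ, ‖c x‖ ^ 2 = ∫ x in Λ, Λ'.indicator (fun x => ‖c₀ x‖ ^ 2) x := by
        refine integral_congr_ae ?_
        filter_upwards [cc] with x hx
        rw [hx]
        by_cases hx : x ∈ Λ' <;> simp [hx]
      rw [this, setIntegral_indicator hΛ', Set.inter_eq_self_of_subset_right hsub]
    rw [this, mul_pow]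
    refine hcomm.trans (mul_le_mul_of_nonneg_right ?_ (sq_nonneg _))
    nlinarith
  have e5 : indicatorOp Λ T hT (G s) = indicatorOp Λ T hT (G (indicatorOp Λ (belt w r)
      (measurableSet_belt w r) c)) := by
    rw [e3, ← sub_eq_zero, ← map_sub, e1, e2]
  rw [e5]
  refine (norm_le_offDiag_mul G hT (measurableSet_belt w r) c).trans ?_
  refine (mul_le_mul_of_nonneg_left e4 (offDiag_nonneg _ _ _)).trans (le_of_eq (by ring))

/-- Crossing a belt: the resolvent between two sets separated by a belt factorizes. -/
lemma IsCutConstant.offDiag_le_mul {E₁ C : ℝ} (hC : IsCutConstant N d E₁ C) (hC0 : 0 ≤ C)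
    {W : Config N d → ℝ} {B₀ : ℝ} (hW : IsBoundedPotential W B₀) {E : ℝ} (hE : E ≤ E₁)
    {Λ : Set (Config N d)} (hΛ : MeasurableSet Λ) {G : L2 Λ →L[ℂ] L2 Λ}
    (hG : IsResolvent W Λ (E : ℂ) G) (u : Lattice N d) {r : ℕ} (hr : 1 ≤ r)
    {T S : Set (Config N d)} (hT : MeasurableSet T) (hS : MeasurableSet S)
    (hSu : ∀ x ∈ S, ‖x - u.toConfig‖ ≤ r - 1 / 2)
    (hTu : ∀ x ∈ T, (r : ℝ) + 1 / 2 ≤ ‖x - u.toConfig‖) :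
    offDiag G T S hT hS ≤ C * offDiag G T (belt u r) hT (measurableSet_belt u r)
      * offDiag G (belt u r) S (measurableSet_belt u r) hS := by
  refine ContinuousLinearMap.opNorm_le_bound _ (mul_nonneg (mul_nonneg hC0 (offDiag_nonneg _ _ _))
    (offDiag_nonneg _ _ _)) fun φ => ?_
  -- The case `Λ' = Λ`, where `f'` is the resolvent of the source itself.
  have h := hC W B₀ hW E hE Λ Λ hΛ hΛ subset_rfl u r hr (fun x hx _ => hx) G hG
    (indicatorOp Λ S hS φ) (indicatorOp Λ S hS φ) (G (indicatorOp Λ S hS φ)) (hG.1 _)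
    Filter.EventuallyEq.rfl ?_ T hT hTu
  · refine h.trans ?_
    rw [mul_assoc (C * _)]
    exact mul_le_mul_of_nonneg_left (norm_le_offDiag_mul G _ hS φ)
      (mul_nonneg hC0 (offDiag_nonneg _ _ _))
  · filter_upwards [coeFn_indicatorOp Λ S hS φ] with x hx hx'
    rw [hx, Set.indicator_of_notMem fun h => hx' (hSu x h)]

/-- The geometric resolvent inequality for a cube contained in `Λ`. -/
lemma IsCutConstant.offDiag_cell_le {E₁ C : ℝ} (hC : IsCutConstant N d E₁ C) (hC0 : 0 ≤ C)
    {W : Config N d → ℝ} {B₀ : ℝ} (hW : IsBoundedPotential W B₀) {E : ℝ} (hE : E ≤ E₁)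
    {Λ : Set (Config N d)} (hΛ : MeasurableSet Λ) {G : L2 Λ →L[ℂ] L2 Λ}
    (hG : IsResolvent W Λ (E : ℂ) G) (w : Lattice N d) {l : ℕ} (hl : 1 ≤ l)
    (hsub : cube w l ⊆ Λ) {G' : L2 (cube w l) →L[ℂ] L2 (cube w l)}
    (hG' : IsResolvent W (cube w l) (E : ℂ) G')
    {T : Set (Config N d)} (hT : MeasurableSet T)
    (hTw : ∀ x ∈ T, (l : ℝ) + 1 / 2 ≤ ‖x - w.toConfig‖) :
    offDiag G T (cell w) hT (measurableSet_cell w)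
      ≤ C * offDiag G T (belt w l) hT (measurableSet_belt w l)
      * offDiag G' (belt w l) (cell w) (measurableSet_belt w l) (measurableSet_cell w) := by
  refine ContinuousLinearMap.opNorm_le_bound _ (mul_nonneg (mul_nonneg hC0 (offDiag_nonneg _ _ _))
    (offDiag_nonneg _ _ _)) fun φ => ?_
  have hl' : (1 : ℝ) ≤ l := by exact_mod_cast hl
  have mφ : MemLp φ 2 (volume.restrict (cube w l)) :=
    (Lp.memLp φ).mono_measure (Measure.restrict_mono hsub le_rfl)
  set φ' : L2 (cube w l) := mφ.toLp with hφ'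
  have cφ : φ' =ᵐ[volume.restrict (cube w l)] φ := mφ.coeFn_toLp
  have nφ : ‖φ'‖ ≤ ‖φ‖ := by
    rw [hφ', Lp.norm_toLp, Lp.norm_def]
    exact ENNReal.toReal_mono (Lp.eLpNorm_ne_top φ)
      (eLpNorm_mono_measure _ (Measure.restrict_mono hsub le_rfl))
  set P := indicatorOp Λ (cell w) (measurableSet_cell w)
  set P' := indicatorOp (cube w l) (cell w) (measurableSet_cell w)
  have hP : P φ =ᵐ[volume.restrict Λ] (cell w).indicator φ := coeFn_indicatorOp _ _ _ _
  have hP' : P' φ' =ᵐ[volume.restrict (cube w l)] (cell w).indicator φ' := coeFn_indicatorOp _ _ _ _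
  -- The comparison solution is now the resolvent of the small cube, applied to the restriction of
  -- the same source, which lives in the cell.
  have h := hC W B₀ hW E hE (cube w l) Λ (measurableSet_cube w l) hΛ hsub w l hl
    (fun x _ hx => hx) G hG (P φ) (P' φ') (G' (P' φ')) (hG'.1 _) ?_ ?_ T hT hTw
  · refine h.trans ?_
    rw [mul_assoc (C * _)]
    refine mul_le_mul_of_nonneg_left ?_ (mul_nonneg hC0 (offDiag_nonneg _ _ _))
    exact (norm_le_offDiag_mul G' _ (measurableSet_cell w) φ').trans
      (mul_le_mul_of_nonneg_left nφ (offDiag_nonneg _ _ _))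
  · filter_upwards [ae_restrict_of_subset_of_ae hsub hP, hP', cφ] with x h1 h2 h3
    rw [h1, h2]
    by_cases hx : x ∈ cell w <;> simp [hx, h3]
  · filter_upwards [hP] with x h1 hx
    rw [h1, Set.indicator_of_notMem]
    intro h
    have : ‖x - w.toConfig‖ ≤ 1 / 2 := h
    exact hx (by linarith)

/-! ### Decomposition into cells -/

/-- The lattice point nearest to `x`. -/
def nearest (x : Config N d) : Lattice N d := fun i j => ⌊x i j + 1 / 2⌋

lemma measurable_nearest : Measurable (nearest : Config N d → Lattice N d) := by
  refine measurable_pi_iff.2 fun i => measurable_pi_iff.2 fun j => ?_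
  exact Int.measurable_floor.comp
    (((measurable_pi_apply j).comp (measurable_pi_apply i)).add_const _)

lemma measurableSet_nearest_eq (w : Lattice N d) : MeasurableSet {x : Config N d | nearest x = w} :=
  measurable_nearest (measurableSet_singleton w)

lemma abs_sub_nearest_le (x : Config N d) (i : Fin N) (j : Fin d) :
    |x i j - (nearest x i j : ℝ)| ≤ 1 / 2 := by
  have h1 := Int.floor_le (x i j + 1 / 2)
  have h2 := Int.lt_floor_add_one (x i j + 1 / 2)
  rw [nearest, abs_le]
  constructor <;> linarith

lemma mem_cell_nearest (x : Config N d) : x ∈ cell (nearest x) :=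
  norm_le_of_forall_coord (by norm_num) fun i j => abs_sub_nearest_le x i j

lemma abs_nearest_sub_le {x : Config N d} {w : Lattice N d} {r : ℕ} (h : x ∈ cube w r)
    (i : Fin N) (j : Fin d) : |nearest x i j - w i j| ≤ r := by
  have h1 := Int.floor_le (x i j + 1 / 2)
  have h2 := Int.lt_floor_add_one (x i j + 1 / 2)
  have h3 : |x i j - (w i j : ℝ)| < r + 1 / 2 :=
    (abs_coord_le_norm (x - w.toConfig) i j).trans_lt h
  rw [abs_lt] at h3
  rw [abs_le]
  have h4 : ((nearest x i j : ℤ) : ℝ) - w i j < r + 1 := by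
    rw [nearest]; linarith
  have h5 : -((r : ℝ) + 1) < ((nearest x i j : ℤ) : ℝ) - w i j := by
    rw [nearest]; linarith
  have h4' : nearest x i j - w i j < (r : ℤ) + 1 := by exact_mod_cast h4
  have h5' : -((r : ℤ) + 1) < nearest x i j - w i j := by exact_mod_cast h5
  constructor <;> omega

/-- The lattice points of the cube of radius `r` centred at `w`. -/
def latticeCube (w : Lattice N d) (r : ℕ) : Finset (Lattice N d) :=
  Fintype.piFinset fun i => Fintype.piFinset fun j => Finset.Icc (w i j - r) (w i j + r)

lemma mem_latticeCube {w w' : Lattice N d} {r : ℕ} :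
    w' ∈ latticeCube w r ↔ ∀ i j, |w' i j - w i j| ≤ r := by
  simp only [latticeCube, Fintype.mem_piFinset, Finset.mem_Icc, abs_le]
  refine forall_congr' fun i => forall_congr' fun j => ?_
  constructor <;> intro h <;> constructor <;> omega

lemma card_latticeCube (w : Lattice N d) (r : ℕ) :
    (latticeCube w r).card = (2 * r + 1) ^ (N * d) := by
  have : ∀ z : ℤ, (z + r + 1 - (z - r)).toNat = 2 * r + 1 := fun z => by omega
  simp only [latticeCube, Fintype.card_piFinset, Int.card_Icc, this, Finset.prod_const,
    Finset.card_univ, Fintype.card_fin]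
  rw [← pow_mul, mul_comm d N]

/-- The decomposition of a cube into cells, by the Cauchy–Schwarz inequality. -/
lemma offDiag_le_of_cell {Λ : Set (Config N d)} (G : L2 Λ →L[ℂ] L2 Λ) {T S : Set (Config N d)}
    (hT : MeasurableSet T) (hS : MeasurableSet S) (w : Lattice N d) (r : ℕ) (hSw : S ⊆ cube w r)
    {Q : ℝ} (hQ0 : 0 ≤ Q)
    (hQ : ∀ x ∈ S, offDiag G T (cell (nearest x)) hT (measurableSet_cell _) ≤ Q) :
    offDiag G T S hT hS ≤ √((2 * r + 1) ^ (N * d)) * Q := by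
  classical
  refine ContinuousLinearMap.opNorm_le_bound _ (by positivity) fun φ => ?_
  set ψ := indicatorOp Λ S hS φ with hψ
  have cψ : ψ =ᵐ[volume.restrict Λ] S.indicator φ := coeFn_indicatorOp _ _ _ _
  set I := (latticeCube w r).filter fun w' => ∃ x ∈ S, nearest x = w' with hI
  -- The level sets of `nearest` partition the space exactly, unlike the closed cells. The pieces
  -- are therefore orthogonal, which yields the square root of the number of cells.
  set A : Lattice N d → L2 Λ := fun w' => indicatorOp Λ _ (measurableSet_nearest_eq w') ψ with hA
  have cA : ∀ w', A w' =ᵐ[volume.restrict Λ] {x : Config N d | nearest x = w'}.indicator ψ :=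
    fun w' => coeFn_indicatorOp _ _ _ _
  have hIx : ∀ x ∈ S, nearest x ∈ I := fun x hx =>
    Finset.mem_filter.2 ⟨mem_latticeCube.2 fun i j => abs_nearest_sub_le (hSw hx) i j, x, hx, rfl⟩
  have h1 : ψ = ∑ w' ∈ I, A w' := by
    refine Lp.ext ?_
    filter_upwards [Lp.coeFn_finsetSum I A, cψ, ae_all_iff.2 cA] with x e1 e2 e3
    rw [e1, Finset.sum_apply]
    simp only [e3, Set.indicator_apply, Set.mem_ofPred_eq, Finset.sum_ite_eq]
    by_cases hx : x ∈ S
    · rw [if_pos (hIx x hx)]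
    · rw [e2]; simp [hx]
  have h2 : ∀ w' ∈ I, ‖indicatorOp Λ T hT (G (A w'))‖ ≤ Q * ‖A w'‖ := by
    intro w' hw'
    obtain ⟨x, hx, rfl⟩ := (Finset.mem_filter.1 hw').2
    have e : indicatorOp Λ (cell (nearest x)) (measurableSet_cell _) (A (nearest x))
        = A (nearest x) := by
      refine indicatorOp_eq_self _ ?_
      filter_upwards [cA (nearest x)] with y h hy
      rw [h, Set.indicator_of_notMem]
      intro h'
      have h'' : nearest y = nearest x := h'
      exact hy (h'' ▸ mem_cell_nearest y)
    rw [← e]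
    refine (norm_le_offDiag_mul G hT (measurableSet_cell _) _).trans ?_
    rw [e]
    exact mul_le_mul_of_nonneg_right (hQ x hx) (norm_nonneg _)
  have h3 : ∑ w' ∈ I, ‖A w'‖ ^ 2 ≤ ‖ψ‖ ^ 2 := by
    have Iψ := integrable_normSq (Lp.memLp ψ)
    have e1 : ∀ w', ‖A w'‖ ^ 2 = ∫ x in Λ, {x : Config N d | nearest x = w'}.indicator
        (fun x => ‖ψ x‖ ^ 2) x := fun w' => norm_sq_indicatorOp _ _
    simp only [e1]
    rw [← integral_finsetSum _ fun w' _ => Iψ.indicator (measurableSet_nearest_eq w'),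
      norm_sq_eq_integral]
    refine integral_mono (integrable_finsetSum _ fun w' _ =>
      Iψ.indicator (measurableSet_nearest_eq w')) Iψ fun x => ?_
    simp only [Set.indicator_apply, Set.mem_ofPred_eq, Finset.sum_ite_eq]
    split_ifs
    · exact le_rfl
    · positivity
  have h4 : ∑ w' ∈ I, ‖A w'‖ ≤ √((2 * r + 1) ^ (N * d)) * ‖φ‖ := by
    refine (pow_le_pow_iff_left₀ (Finset.sum_nonneg fun _ _ => norm_nonneg _) (by positivity)
      two_ne_zero).1 ?_
    rw [mul_pow, Real.sq_sqrt (by positivity)]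
    refine sq_sum_le_card_mul_sum_sq.trans ?_
    have c1 : (I.card : ℝ) ≤ (2 * r + 1) ^ (N * d) := by
      have := Finset.card_filter_le (latticeCube w r) fun w' => ∃ x ∈ S, nearest x = w'
      rw [card_latticeCube] at this
      exact_mod_cast this
    have c2 : ‖ψ‖ ^ 2 ≤ ‖φ‖ ^ 2 :=
      pow_le_pow_left₀ (norm_nonneg _) (norm_indicatorOp_apply_le _ _ _ _) 2
    exact mul_le_mul c1 (h3.trans c2) (Finset.sum_nonneg fun _ _ => sq_nonneg _) (by positivity)
  change ‖indicatorOp Λ T hT (G ψ)‖ ≤ _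
  rw [h1, map_sum, map_sum]
  refine (norm_sum_le _ _).trans ((Finset.sum_le_sum h2).trans ?_)
  rw [← Finset.mul_sum]
  calc Q * ∑ w' ∈ I, ‖A w'‖ ≤ Q * (√((2 * r + 1) ^ (N * d)) * ‖φ‖) :=
        mul_le_mul_of_nonneg_left h4 hQ0
    _ = _ := by ring

/-! ### Iteration of the resolvent inequality -/

/-- The resolvent `G` of a bounded potential at an energy `E ≤ E₁` in a cube, bounded by `κ`. -/
structure IsControlledResolvent (E₁ C κ : ℝ) (W : Config N d → ℝ) (E : ℝ) (u : Lattice N d) (L : ℕ)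
    (G : L2 (cube u L) →L[ℂ] L2 (cube u L)) : Prop where
  isCutConstant : IsCutConstant N d E₁ C
  one_le : 1 ≤ C
  isBoundedPotential : ∃ B₀, IsBoundedPotential W B₀
  energy_le : E ≤ E₁
  isResolvent : IsResolvent W (cube u L) (E : ℂ) G
  norm_le : ‖G‖ ≤ κ

/-- The gain of one step of length `l` through nonsingular cubes. -/
def stepFactor (N d : ℕ) (C C_geom m : ℝ) (l : ℕ) : ℝ :=
  C * √((2 * l + 1) ^ (N * d)) * (Real.exp (-(m * l)) / (C_geom * (3 * l) ^ (N * d)))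

lemma stepFactor_nonneg {C C_geom : ℝ} (hC : 0 ≤ C) (hg : 0 ≤ C_geom) (m : ℝ) (l : ℕ) :
    0 ≤ stepFactor N d C C_geom m l := by
  unfold stepFactor; positivity

lemma norm_toConfig_sub_le {w w' : Lattice N d} {r : ℕ} (h : ∀ i j, |w' i j - w i j| ≤ r) :
    ‖w'.toConfig - w.toConfig‖ ≤ r :=
  norm_le_of_forall_coord (by positivity) fun i j => by
    have := h i j
    change |(w' i j : ℝ) - w i j| ≤ r
    exact_mod_cast this

variable {E₁ C κ E C_geom m : ℝ} {W : Config N d → ℝ} {u : Lattice N d} {L l : ℕ}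
  {G : L2 (cube u L) →L[ℂ] L2 (cube u L)}

/-- One step of the walk: the source moves from the cell at `w` to the belt of a nonsingular cube
around it, and from there to the worst cell met by that belt. -/
lemma IsControlledResolvent.offDiag_cell_step (h : IsControlledResolvent E₁ C κ W E u L G)
    (hg : 0 < C_geom) (hl : 1 ≤ l) {w : Lattice N d} (hsub : cube w l ⊆ cube u L)
    (hns : IsNonsingular C_geom W E m w l) {T : Set (Config N d)} (hT : MeasurableSet T)
    (hTw : ∀ x ∈ T, (l : ℝ) + 1 / 2 ≤ ‖x - w.toConfig‖) {Q : ℝ} (hQ0 : 0 ≤ Q)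
    (hQ : ∀ w' : Lattice N d, ‖w'.toConfig - w.toConfig‖ ≤ l →
      offDiag G T (cell w') hT (measurableSet_cell w') ≤ Q) :
    offDiag G T (cell w) hT (measurableSet_cell w) ≤ stepFactor N d C C_geom m l * Q := by
  obtain ⟨G', hG', hn⟩ := hns
  obtain ⟨B₀, hW⟩ := h.isBoundedPotential
  have hC0 : 0 ≤ C := zero_le_one.trans h.one_le
  have h1 := h.isCutConstant.offDiag_cell_le hC0 hW h.energy_le (measurableSet_cube u L)
    h.isResolvent w hl hsub hG' hT hTw
  have h2 := offDiag_le_of_cell G hT (measurableSet_belt w l) w l (fun x hx => hx.2) hQ0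
    fun x hx => hQ _ (norm_toConfig_sub_le (abs_nearest_sub_le hx.2))
  have hl' : (0 : ℝ) < l := by exact_mod_cast hl
  have h3 : offDiag G' (belt w l) (cell w) (measurableSet_belt w l) (measurableSet_cell w)
      ≤ Real.exp (-(m * l)) / (C_geom * (3 * l) ^ (N * d)) := by
    rw [le_div_iff₀ (by positivity), mul_comm]
    exact hn
  refine h1.trans ?_
  refine (mul_le_mul (mul_le_mul_of_nonneg_left h2 hC0) h3 (offDiag_nonneg _ _ _)
    (by positivity)).trans (le_of_eq ?_)
  rw [stepFactor]; ring

/-- Each step moves the centre by at most `l`, so a walk starting at depth `k * l` inside the shell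
takes `k` steps before it can leave. The extra margin `1` keeps the target outside the open cube of
radius `l + 1/2` around each centre. -/
lemma IsControlledResolvent.offDiag_cell_iterate (h : IsControlledResolvent E₁ C κ W E u L G)
    (hg : 0 < C_geom) (hl : 1 ≤ l) {a b : ℝ}
    (hns : ∀ w : Lattice N d, a < ‖w.toConfig - u.toConfig‖ → ‖w.toConfig - u.toConfig‖ < b →
      cube w l ⊆ cube u L ∧ IsNonsingular C_geom W E m w l)
    {T : Set (Config N d)} (hT : MeasurableSet T)
    (hTu : ∀ x ∈ T, ‖x - u.toConfig‖ ≤ a + 1 / 2 ∨ b - 1 / 2 ≤ ‖x - u.toConfig‖) (k : ℕ)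
    (w : Lattice N d) (h1 : a + 1 + k * l ≤ ‖w.toConfig - u.toConfig‖)
    (h2 : ‖w.toConfig - u.toConfig‖ ≤ b - 1 - k * l) :
    offDiag G T (cell w) hT (measurableSet_cell w) ≤ stepFactor N d C C_geom m l ^ k * κ := by
  have hq := stepFactor_nonneg (N := N) (d := d) (zero_le_one.trans h.one_le) hg.le m l
  have hκ : 0 ≤ κ := (norm_nonneg _).trans h.norm_le
  induction k generalizing w with
  | zero => rw [pow_zero, one_mul]; exact (offDiag_le_norm _ _ _).trans h.norm_le
  | succ k ih =>
    push_cast at h1 h2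
    have hkl : (0 : ℝ) ≤ k * l := by positivity
    have hl' : (0 : ℝ) ≤ l := by positivity
    obtain ⟨hsub, hw⟩ := hns w (by linarith) (by linarith)
    rw [pow_succ', mul_assoc]
    refine h.offDiag_cell_step hg hl hsub hw hT (fun x hx => ?_) (by positivity) fun w' hw' => ?_
    · rcases hTu x hx with hx | hx
      · have := norm_sub_le_norm_sub_add_norm_sub w.toConfig x u.toConfig
        rw [norm_sub_rev w.toConfig x] at this
        linarith
      · have := norm_sub_le_norm_sub_add_norm_sub x w.toConfig u.toConfig
        linarith
    · have e1 := norm_sub_le_norm_sub_add_norm_sub w'.toConfig w.toConfig u.toConfig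
      have e2 := norm_sub_le_norm_sub_add_norm_sub w.toConfig w'.toConfig u.toConfig
      rw [norm_sub_rev w.toConfig w'.toConfig] at e2
      exact ih w' (by linarith) (by linarith)

/-- Crossing a shell all of whose cubes are nonsingular. -/
lemma IsControlledResolvent.offDiag_belt_le (h : IsControlledResolvent E₁ C κ W E u L G)
    (hg : 0 < C_geom) (hl : 1 ≤ l) {a b r k : ℕ}
    (hns : ∀ w : Lattice N d, a < ‖w.toConfig - u.toConfig‖ → ‖w.toConfig - u.toConfig‖ < b →
      cube w l ⊆ cube u L ∧ IsNonsingular C_geom W E m w l)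
    (hr1 : a + 2 + k * l ≤ r) (hr2 : r + 2 + k * l ≤ b) (hrL : r ≤ L) :
    offDiag G (belt u b) (belt u a) (measurableSet_belt u b) (measurableSet_belt u a)
      ≤ C * (2 * L + 1) ^ (N * d) * κ ^ 2 * stepFactor N d C C_geom m l ^ (2 * k) := by
  obtain ⟨B₀, hW⟩ := h.isBoundedPotential
  have hC0 : 0 ≤ C := zero_le_one.trans h.one_le
  have hq := stepFactor_nonneg (N := N) (d := d) hC0 hg.le m l
  have hκ : 0 ≤ κ := (norm_nonneg _).trans h.norm_le
  have hr1' : (a : ℝ) + 2 + k * l ≤ r := by exact_mod_cast hr1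
  have hr2' : (r : ℝ) + 2 + k * l ≤ b := by exact_mod_cast hr2
  have hkl : (0 : ℝ) ≤ k * l := by positivity
  -- The cut at the middle radius `r` gives two factors, each worth `k` steps.
  have h1 := h.isCutConstant.offDiag_le_mul hC0 hW h.energy_le (measurableSet_cube u L)
    h.isResolvent u (r := r) (by omega) (measurableSet_belt u b) (measurableSet_belt u a)
    (fun x hx => by linarith [hx.2]) (fun x hx => by linarith [hx.1])
  have key : ∀ (T : Set (Config N d)) (hT : MeasurableSet T),
      (∀ x ∈ T, ‖x - u.toConfig‖ ≤ a + 1 / 2 ∨ b - 1 / 2 ≤ ‖x - u.toConfig‖) →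
      offDiag G T (belt u r) hT (measurableSet_belt u r)
        ≤ √((2 * r + 1) ^ (N * d)) * (stepFactor N d C C_geom m l ^ k * κ) := by
    intro T hT hTu
    refine offDiag_le_of_cell G hT (measurableSet_belt u r) u r (fun x hx => hx.2) (by positivity)
      fun x hx => ?_
    have hc : ‖x - (nearest x).toConfig‖ ≤ 1 / 2 := mem_cell_nearest x
    have e1 := norm_sub_le_norm_sub_add_norm_sub (nearest x).toConfig x u.toConfig
    have e2 := norm_sub_le_norm_sub_add_norm_sub x (nearest x).toConfig u.toConfig
    rw [norm_sub_rev _ x] at e1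
    exact h.offDiag_cell_iterate hg hl hns hT hTu k _ (by linarith [hx.1]) (by linarith [hx.2])
  have h2 := key (belt u b) (measurableSet_belt u b) fun x hx => Or.inr hx.1.le
  have h3 := key (belt u a) (measurableSet_belt u a) fun x hx => Or.inl hx.2.le
  -- The inner factor has its source on the belt at `a`; flipping it puts the starting cells at
  -- radius `r`.
  rw [offDiag_comm (h.isResolvent.isSelfAdjoint hW)] at h3
  have hrL' : (r : ℝ) ≤ L := by exact_mod_cast hrL
  refine h1.trans ((mul_le_mul (mul_le_mul_of_nonneg_left h2 hC0) h3 (offDiag_nonneg _ _ _)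
    (by positivity)).trans ?_)
  have e : C * (√((2 * r + 1) ^ (N * d)) * (stepFactor N d C C_geom m l ^ k * κ))
      * (√((2 * r + 1) ^ (N * d)) * (stepFactor N d C C_geom m l ^ k * κ))
      = C * (√((2 * (r : ℝ) + 1) ^ (N * d)) * √((2 * r + 1) ^ (N * d))) * κ ^ 2
        * stepFactor N d C C_geom m l ^ (2 * k) := by ring
  rw [e, Real.mul_self_sqrt (by positivity)]
  gcongr

/-- Crossing the belts at the radii `D, 2D, …, (n+1)D` in turn. -/
lemma IsControlledResolvent.offDiag_le_prod (h : IsControlledResolvent E₁ C κ W E u L G)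
    {D : ℕ} (hD : 1 ≤ D) (n : ℕ) :
    offDiag G (belt u ((n + 1) * D)) (cell u) (measurableSet_belt _ _) (measurableSet_cell u)
      ≤ κ * ∏ j ∈ Finset.range n, (C * offDiag G (belt u ((j + 2) * D)) (belt u ((j + 1) * D))
        (measurableSet_belt _ _) (measurableSet_belt _ _)) := by
  obtain ⟨B₀, hW⟩ := h.isBoundedPotential
  have hC0 : 0 ≤ C := zero_le_one.trans h.one_le
  induction n with
  -- No decay is claimed between the centre and the first belt.
  | zero => simpa using (offDiag_le_norm _ _ _).trans h.norm_le
  | succ n ih =>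
    have hD' : (1 : ℝ) ≤ D := by exact_mod_cast hD
    have hnD : (1 : ℝ) ≤ (n + 1) * D := by nlinarith [(Nat.cast_nonneg n : (0 : ℝ) ≤ n)]
    have h1 := h.isCutConstant.offDiag_le_mul hC0 hW h.energy_le (measurableSet_cube u L)
      h.isResolvent u (r := (n + 1) * D) (by nlinarith) (measurableSet_belt u ((n + 1 + 1) * D))
      (measurableSet_cell u)
      (fun x hx => by
        have : ‖x - u.toConfig‖ ≤ 1 / 2 := hx
        push_cast
        linarith)
      (fun x hx => by
        have := hx.1
        push_cast at this ⊢
        linarith)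
    rw [Finset.prod_range_succ]
    refine h1.trans ((mul_le_mul_of_nonneg_left ih (mul_nonneg hC0 (offDiag_nonneg _ _ _))).trans
      (le_of_eq ?_))
    have e : n + 1 + 1 = n + 2 := rfl
    rw [e]
    ring

/-- The resolvent between the centre and the boundary of a cube, when all but `b` of the shells of
width `D` are free of singular cubes. -/
lemma IsControlledResolvent.offDiag_boundary_le (h : IsControlledResolvent E₁ C κ W E u L G)
    (hκ : 1 ≤ κ) {D n : ℕ} (hD : 1 ≤ D) (hL : (n + 1) * D + 1 ≤ L) {q : ℝ} (hq : 0 ≤ q)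
    (hq1 : q ≤ 1) (bad : Finset ℕ)
    (hgood : ∀ j < n, j ∉ bad → offDiag G (belt u ((j + 2) * D)) (belt u ((j + 1) * D))
        (measurableSet_belt _ _) (measurableSet_belt _ _) ≤ C * (2 * L + 1) ^ (N * d) * κ ^ 2 * q) :
    offDiag G (belt u L) (cell u) (measurableSet_belt _ _) (measurableSet_cell u)
      ≤ (C ^ 2 * (2 * L + 1) ^ (N * d) * κ ^ 2) ^ (n + 1) * q ^ (n - bad.card) := by
  classical
  obtain ⟨B₀, hW⟩ := h.isBoundedPotential
  have hC0 : 0 ≤ C := zero_le_one.trans h.one_le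
  have hκ0 : 0 ≤ κ := zero_le_one.trans hκ
  have hC1 := h.one_le
  have hP : (1 : ℝ) ≤ (2 * L + 1) ^ (N * d) :=
    one_le_pow₀ (by linarith [(Nat.cast_nonneg L : (0 : ℝ) ≤ L)])
  set P : ℝ := (2 * L + 1) ^ (N * d)
  set A : ℝ := C ^ 2 * P * κ ^ 2 with hA
  have hD' : (1 : ℝ) ≤ D := by exact_mod_cast hD
  have hnD : (1 : ℝ) ≤ (n + 1) * D := by nlinarith [(Nat.cast_nonneg n : (0 : ℝ) ≤ n)]
  have hL' : ((n : ℝ) + 1) * D + 1 ≤ L := by exact_mod_cast hL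
  -- The last cut joins the belt at `(n + 1) * D` to the boundary belt; that stretch is also crossed
  -- by the norm bound alone.
  have h1 := h.isCutConstant.offDiag_le_mul hC0 hW h.energy_le (measurableSet_cube u L)
      h.isResolvent u (r := (n + 1) * D) (by nlinarith) (measurableSet_belt u L)
      (measurableSet_cell u)
      (fun x hx => by
        have : ‖x - u.toConfig‖ ≤ 1 / 2 := hx
        push_cast
        linarith)
      (fun x hx => by
        have := hx.1
        push_cast
        linarith)
  have h2 := h.offDiag_le_prod hD n
  have hCA : C * κ ≤ A := by
    have : C * κ * 1 ≤ C * κ * (C * κ * P) :=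
      mul_le_mul_of_nonneg_left (one_le_mul_of_one_le_of_one_le
        (one_le_mul_of_one_le_of_one_le hC1 hκ) hP) (by positivity)
    calc C * κ = C * κ * 1 := (mul_one _).symm
      _ ≤ _ := this
      _ = A := by rw [hA]; ring
  have hCA' : C * κ * κ ≤ A := by
    have : C * κ * κ * 1 ≤ C * κ * κ * (C * P) :=
      mul_le_mul_of_nonneg_left (one_le_mul_of_one_le_of_one_le hC1 hP) (by positivity)
    calc C * κ * κ = C * κ * κ * 1 := (mul_one _).symm
      _ ≤ _ := this
      _ = A := by rw [hA]; ring
  have hA0 : 0 ≤ A := by positivity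
  have h3 : ∏ j ∈ Finset.range n, (C * offDiag G (belt u ((j + 2) * D)) (belt u ((j + 1) * D))
        (measurableSet_belt _ _) (measurableSet_belt _ _)) ≤ A ^ n * q ^ (n - bad.card) := by
    have e1 : ∀ j ∈ Finset.range n, C * offDiag G (belt u ((j + 2) * D)) (belt u ((j + 1) * D))
        (measurableSet_belt _ _) (measurableSet_belt _ _) ≤ A * if j ∈ bad then 1 else q := by
      intro j hj
      split_ifs with hjb
      · rw [mul_one]
        exact (mul_le_mul_of_nonneg_left ((offDiag_le_norm _ _ _).trans h.norm_le) hC0).trans hCA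
      · refine (mul_le_mul_of_nonneg_left (hgood j (Finset.mem_range.1 hj) hjb) hC0).trans
          (le_of_eq ?_)
        rw [hA]; ring
    refine (Finset.prod_le_prod (fun j _ => mul_nonneg hC0 (offDiag_nonneg _ _ _)) e1).trans ?_
    rw [Finset.prod_mul_distrib, Finset.prod_const, Finset.card_range, Finset.prod_ite,
      Finset.prod_const_one, one_mul, Finset.prod_const]
    -- At least `n - bad.card` of the `n` shells are clean, even if `bad` has elements outside the
    -- range; since `q ≤ 1`, further clean shells only help.
    refine mul_le_mul_of_nonneg_left (pow_le_pow_of_le_one hq hq1 ?_) (by positivity)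
    have e2 := Finset.le_card_sdiff bad (Finset.range n)
    rw [Finset.card_range] at e2
    refine e2.trans (Finset.card_le_card fun j hj => ?_)
    rw [Finset.mem_sdiff] at hj
    exact Finset.mem_filter.2 hj
  calc offDiag G (belt u L) (cell u) (measurableSet_belt _ _) (measurableSet_cell u)
      ≤ C * κ * (κ * (A ^ n * q ^ (n - bad.card))) := by
        refine h1.trans (mul_le_mul (mul_le_mul_of_nonneg_left
          ((offDiag_le_norm _ _ _).trans h.norm_le) hC0)
          (h2.trans (mul_le_mul_of_nonneg_left h3 hκ0)) (offDiag_nonneg _ _ _) (by positivity))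
    _ = C * κ * κ * (A ^ n * q ^ (n - bad.card)) := by ring
    _ ≤ A * (A ^ n * q ^ (n - bad.card)) := mul_le_mul_of_nonneg_right hCA' (by positivity)
    _ = _ := by rw [pow_succ]; ring

/-! ### Counting shells with singular cubes -/

/-- A separated family of largest cardinality exists because cardinalities are bounded by `K`. A
point separated from all its members could be added to it. -/
lemma exists_maximal_separated {ι : Type*} (p : ι → Prop) (r : ι → ι → Prop)
    (hr : ∀ a b, r a b → r b a) (K : ℕ)
    (hK : ∀ s : Finset ι, (∀ a ∈ s, p a) → (∀ a ∈ s, ∀ b ∈ s, a ≠ b → r a b) → s.card ≤ K) :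
    ∃ s : Finset ι, s.card ≤ K ∧ ∀ a, p a → ∃ b ∈ s, a = b ∨ ¬ r a b := by
  classical
  set A : Set ℕ := {n | ∃ s : Finset ι, (∀ a ∈ s, p a) ∧
    (∀ a ∈ s, ∀ b ∈ s, a ≠ b → r a b) ∧ s.card = n} with hA
  have hbdd : BddAbove A := ⟨K, by rintro n ⟨s, h1, h2, rfl⟩; exact hK s h1 h2⟩
  obtain ⟨s, h1, h2, h3⟩ := Nat.sSup_mem (s := A) ⟨0, ∅, by simp, by simp, rfl⟩ hbdd
  refine ⟨s, hK s h1 h2, fun a ha => ?_⟩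
  by_contra! hn
  have has : a ∉ s := fun h => (hn a h).1 rfl
  have h4 : (insert a s).card ∈ A := by
    refine ⟨insert a s, ?_, ?_, rfl⟩
    · intro b hb
      rcases Finset.mem_insert.1 hb with rfl | hb
      exacts [ha, h1 b hb]
    · intro b hb c hc hbc
      rcases Finset.mem_insert.1 hb with hb' | hb' <;>
        rcases Finset.mem_insert.1 hc with hc' | hc'
      · exact absurd (hb'.trans hc'.symm) hbc
      · exact hb' ▸ (hn c hc').2
      · exact hr _ _ (hc' ▸ (hn b hb').2)
      · exact h2 b hb' c hc' hbc
  have h5 := le_csSup hbdd h4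
  rw [Finset.card_insert_of_notMem has] at h5
  omega

lemma card_le_of_forall_mem_Ioo {J : Finset ℕ} {x y : ℝ} (hy : 0 ≤ y)
    (h : ∀ j ∈ J, x < j ∧ (j : ℝ) < x + y) : (J.card : ℝ) ≤ y + 1 := by
  rcases J.eq_empty_or_nonempty with rfl | hJ
  · simp only [Finset.card_empty, Nat.cast_zero]; linarith
  · have h1 : J ⊆ Finset.Icc (J.min' hJ) (J.max' hJ) := fun j hj =>
      Finset.mem_Icc.2 ⟨J.min'_le j hj, J.le_max' j hj⟩
    have h2 := Finset.card_le_card h1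
    rw [Nat.card_Icc] at h2
    have h3 := (h _ (J.min'_mem hJ)).1
    have h4 := (h _ (J.max'_mem hJ)).2
    have h5 : J.card + J.min' hJ ≤ J.max' hJ + 1 := by
      have := J.min'_le _ (J.max'_mem hJ)
      omega
    have h6 : (J.card : ℝ) + J.min' hJ ≤ J.max' hJ + 1 := by exact_mod_cast h5
    linarith

lemma norm_sub_lt_of_not_areDistant {R : ℝ} {w w' : Lattice N d} {l : ℕ}
    (h : ¬ AreDistant R (cube w l) (cube w' l)) :
    ‖w.toConfig - w'.toConfig‖ < R + (2 * l + 1) := by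
  simp only [AreDistant, not_forall, not_le] at h
  obtain ⟨x, hx, y, hy, hxy⟩ := h
  have hx' : ‖x - w.toConfig‖ < l + 1 / 2 := hx
  have hy' : ‖y - w'.toConfig‖ < l + 1 / 2 := hy
  rw [dist_eq_norm] at hxy
  have e1 := norm_sub_le_norm_sub_add_norm_sub w.toConfig x w'.toConfig
  have e2 := norm_sub_le_norm_sub_add_norm_sub x y w'.toConfig
  rw [norm_sub_rev _ x] at e1
  linarith

lemma cube_subset_cube {w u : Lattice N d} {l L : ℕ}
    (h : ‖w.toConfig - u.toConfig‖ + l ≤ L) : cube w l ⊆ cube u L := by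
  intro x hx
  have hx' : ‖x - w.toConfig‖ < l + 1 / 2 := hx
  have e1 := norm_sub_le_norm_sub_add_norm_sub x w.toConfig u.toConfig
  change ‖x - u.toConfig‖ < L + 1 / 2
  linarith

/-- In a good cube, the shells that meet singular cubes are few. -/
lemma exists_bad_shells {C_geom τ E m : ℝ} {W : Config N d → ℝ} {K : ℕ} {u : Lattice N d}
    {l L : ℕ} (hgood : ¬ IsBad C_geom W τ K E m u l L) {D : ℕ} (hD : 1 ≤ D) (n : ℕ) :
    ∃ bad : Finset ℕ,
      (bad.card : ℝ) ≤ K * (2 * (9 * N * (l : ℝ) ^ τ + (2 * l + 1)) / D + 2) ∧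
      ∀ j < n, j ∉ bad → ∀ w : Lattice N d, cube w l ⊆ cube u L →
        ((j + 1) * D : ℝ) < ‖w.toConfig - u.toConfig‖ →
        ‖w.toConfig - u.toConfig‖ < ((j + 2) * D : ℝ) → IsNonsingular C_geom W E m w l := by
  classical
  rw [IsBad, not_or] at hgood
  obtain ⟨hg1, hg2⟩ := hgood
  push Not at hg1 hg2
  set R : ℝ := 9 * N * (l : ℝ) ^ τ with hR
  have hR0 : 0 ≤ R := by positivity
  set R' : ℝ := R + (2 * l + 1) with hR'
  have hR'0 : 0 < R' := by positivity
  have hD' : (0 : ℝ) < D := by exact_mod_cast hD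
  obtain ⟨s, hs, hsep⟩ := exists_maximal_separated
    (fun w : Lattice N d => cube w l ⊆ cube u L ∧ ¬ IsNonsingular C_geom W E m w l)
    (fun w w' => AreDistant R (cube w l) (cube w' l))
    (fun w w' h x hx y hy => by rw [dist_comm]; exact h y hy x hx) K (by
      intro s h1 h2
      by_contra hc
      -- Goodness excludes weakly interactive singular cubes, so all singular cubes are strongly
      -- interactive and the count by `K` applies to them.
      obtain ⟨w, hw, w', hw', hne, hd⟩ := hg2 s (by omega) fun w hw =>
        ⟨(h1 w hw).1, fun hwi => (h1 w hw).2 (hg1 w (h1 w hw).1 hwi), (h1 w hw).2⟩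
      exact hd (h2 w hw w' hw' hne))
  -- These are the shells meeting the range of radii within `R'` of that of `w'`. Only the distance
  -- to the centre `u` matters.
  set near : Lattice N d → Finset ℕ := fun w' => (Finset.range n).filter fun j =>
    ((j + 1) * D : ℝ) < ‖w'.toConfig - u.toConfig‖ + R' ∧
      ‖w'.toConfig - u.toConfig‖ - R' < ((j + 2) * D : ℝ) with hnear
  refine ⟨s.biUnion near, ?_, fun j hj hjb w hwsub hw1 hw2 => ?_⟩
  · have h1 : ∀ w' ∈ s, ((near w').card : ℝ) ≤ 2 * R' / D + 2 := by
      intro w' _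
      have := card_le_of_forall_mem_Ioo (J := near w')
        (x := (‖w'.toConfig - u.toConfig‖ - R') / D - 2) (y := 2 * R' / D + 1) (by positivity)
        fun j hj => by
          obtain ⟨h1, h2⟩ := (Finset.mem_filter.1 hj).2
          have e1 := (div_lt_iff₀ hD').2 h2
          have e2 := (lt_div_iff₀ hD').2 h1
          have e3 : (‖w'.toConfig - u.toConfig‖ + R') / D
              = (‖w'.toConfig - u.toConfig‖ - R') / D + 2 * R' / D := by ring
          constructor <;> linarith
      linarith
    calc ((s.biUnion near).card : ℝ) ≤ ∑ w' ∈ s, ((near w').card : ℝ) := by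
          exact_mod_cast Finset.card_biUnion_le
      _ ≤ ∑ _w' ∈ s, (2 * R' / D + 2) := Finset.sum_le_sum h1
      _ = s.card * (2 * R' / D + 2) := by rw [Finset.sum_const, nsmul_eq_mul]
      _ ≤ K * (2 * R' / D + 2) := by
          refine mul_le_mul_of_nonneg_right (by exact_mod_cast hs) (by positivity)
  · by_contra hns
    obtain ⟨w', hw's, hw'⟩ := hsep w ⟨hwsub, hns⟩
    have hdist : ‖w.toConfig - w'.toConfig‖ < R' := by
      rcases hw' with rfl | h
      · simpa using hR'0
      · exact norm_sub_lt_of_not_areDistant h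
    refine hjb (Finset.mem_biUnion.2 ⟨w', hw's, Finset.mem_filter.2 ⟨Finset.mem_range.2 hj, ?_, ?_⟩⟩)
    · have := norm_sub_le_norm_sub_add_norm_sub w.toConfig w'.toConfig u.toConfig
      linarith
    · have := norm_sub_le_norm_sub_add_norm_sub w'.toConfig w.toConfig u.toConfig
      rw [norm_sub_rev w'.toConfig w.toConfig] at this
      linarith

/-! ### The numerical estimate -/

/-- The normalization `(3l) ^ (N * d)` exceeds the square root paid for the cells by at least `√l`,
as `N * d ≥ 1`. This is the surplus that absorbs every loss. -/
lemma stepFactor_le_exp {C C_geom m : ℝ} (hC : 0 < C) (hg : 0 < C_geom) {l : ℕ} (hl : 1 ≤ l)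
    (hNd : 1 ≤ N * d) :
    stepFactor N d C C_geom m l
      ≤ Real.exp (-(m * l + (Real.log l / 2 - Real.log (C / C_geom)))) := by
  have hl' : (1 : ℝ) ≤ l := by exact_mod_cast hl
  have h1 : √((2 * l + 1) ^ (N * d)) ≤ √((3 * (l : ℝ)) ^ (N * d)) :=
    Real.sqrt_le_sqrt (pow_le_pow_left₀ (by positivity) (by linarith) _)
  have h2 : √(l : ℝ) ≤ √((3 * (l : ℝ)) ^ (N * d)) := by
    refine Real.sqrt_le_sqrt ?_
    calc (l : ℝ) ≤ 3 * l := by linarith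
      _ ≤ (3 * (l : ℝ)) ^ (N * d) := le_self_pow₀ (by linarith) (by omega)
  have hs : 0 < √(l : ℝ) := Real.sqrt_pos.2 (by linarith)
  have h3 : Real.exp (-(m * l + (Real.log l / 2 - Real.log (C / C_geom))))
      = C / C_geom * (√(l : ℝ))⁻¹ * Real.exp (-(m * l)) := by
    rw [show -(m * l + (Real.log l / 2 - Real.log (C / C_geom)))
      = Real.log (C / C_geom) + -(Real.log l / 2) + -(m * l) by ring, Real.exp_add, Real.exp_add,
      Real.exp_log (by positivity), Real.exp_neg, ← Real.log_sqrt (by positivity), Real.exp_log hs]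
  rw [h3, stepFactor]
  set P : ℝ := (3 * (l : ℝ)) ^ (N * d) with hP
  have hP0 : 0 < P := by positivity
  have hsP : 0 < √P := Real.sqrt_pos.2 hP0
  calc C * √((2 * l + 1) ^ (N * d)) * (Real.exp (-(m * l)) / (C_geom * P))
      ≤ C * √P * (Real.exp (-(m * l)) / (C_geom * P)) := by gcongr
    _ = C / C_geom * (√P)⁻¹ * Real.exp (-(m * l)) := by
        have : P = √P * √P := (Real.mul_self_sqrt hP0.le).symm
        rw [this, Real.sqrt_mul_self hsP.le]
        field_simp
    _ ≤ _ := by gcongr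

/-- The exponents add up: the gain `g` per step outweighs all losses. -/
lemma exponent_estimate {l X b m M g a₀ a₁ c_b c₂ : ℝ} (hl : 4 ≤ l) (hX : l ≤ X) (hb0 : 0 ≤ b)
    (hm : 0 ≤ m) (hM : m ≤ M) (hcb : 0 ≤ c_b) (hb : l * b ≤ c_b * X) (hlb : 2 * (2 + c_b) ≤ l)
    (ha₀ : a₀ ≤ c₂ * l) (ha₁ : a₁ ≤ c₂ * (l * X)) (hg : 4 * (M * (4 + c_b) + 2 * c₂) ≤ g)
    (hg0 : 0 ≤ g) :
    a₁ + X * a₀ - (m * l + g) * (l - 2) * (X - 2 - b) ≤ -(m * (l ^ 2 * X)) := by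
  have hX0 : 0 < X := by linarith
  -- At least half of the shells are clean, so at least `l * X / 4` steps contribute the surplus
  -- `g`.
  have hb2 : 2 + b ≤ X / 2 := by
    have h1 : l * (2 + b) ≤ (2 + c_b) * X := by nlinarith
    have h2 : (2 + c_b) * X ≤ l / 2 * X := mul_le_mul_of_nonneg_right (by linarith) hX0.le
    have h3 : l * (2 + b) ≤ l * (X / 2) := by linarith
    exact le_of_mul_le_mul_left h3 (by linarith)
  have h1 : g * (l * X / 4) ≤ g * ((l - 2) * (X - 2 - b)) := by
    refine mul_le_mul_of_nonneg_left ?_ hg0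
    calc l * X / 4 = l / 2 * (X / 2) := by ring
      _ ≤ (l - 2) * (X - 2 - b) := mul_le_mul (by linarith) (by linarith) (by positivity)
          (by linarith)
  have h2 : m * (l ^ 2 * X) - m * l * (l - 2) * (X - 2 - b) ≤ M * ((4 + c_b) * (l * X)) := by
    -- The length missed by the walk: `2 l X` from rounding within shells, at most `2 l X` from the
    -- two missing shells, and `c_b l X` from the bad ones.
    have e1 : l ^ 2 * X - l * (l - 2) * (X - 2 - b) ≤ (4 + c_b) * (l * X) := by
      have e2 : l * (l * b) ≤ l * (c_b * X) := mul_le_mul_of_nonneg_left hb (by linarith)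
      have e3 : l * l ≤ l * X := mul_le_mul_of_nonneg_left hX (by linarith)
      have e4 : 0 ≤ l * (2 + b) := by positivity
      nlinarith
    have e5 : 0 ≤ (4 + c_b) * (l * X) := by positivity
    calc m * (l ^ 2 * X) - m * l * (l - 2) * (X - 2 - b)
        = m * (l ^ 2 * X - l * (l - 2) * (X - 2 - b)) := by ring
      _ ≤ m * ((4 + c_b) * (l * X)) := mul_le_mul_of_nonneg_left e1 hm
      _ ≤ M * ((4 + c_b) * (l * X)) := mul_le_mul_of_nonneg_right hM e5
  have h3 : X * a₀ ≤ c₂ * (l * X) := by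
    calc X * a₀ ≤ X * (c₂ * l) := mul_le_mul_of_nonneg_left ha₀ hX0.le
      _ = _ := by ring
  have h4 : 4 * (M * (4 + c_b) + 2 * c₂) * (l * X / 4) ≤ g * (l * X / 4) :=
    mul_le_mul_of_nonneg_right hg (by positivity)
  nlinarith

lemma log_three_mul_pow_le {l : ℝ} (hl : 1 ≤ l) (α : ℕ) :
    Real.log (3 * l ^ α) ≤ (2 + α) * l := by
  rw [Real.log_mul (by norm_num) (by positivity), Real.log_pow]
  have h1 := Real.log_le_sub_one_of_pos (show (0 : ℝ) < 3 by norm_num)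
  have h2 := Real.log_le_sub_one_of_pos (show (0 : ℝ) < l by linarith)
  have h3 : (α : ℝ) * Real.log l ≤ α * l := mul_le_mul_of_nonneg_left (by linarith) (by positivity)
  nlinarith

lemma bad_shells_le (N K : ℕ) {l τ : ℝ} {α : ℕ} (hl : 1 ≤ l) (hτ : 1 < τ) (hα : 2 * τ < (α : ℝ))
    (hα3 : 3 ≤ α) :
    l * (K * (2 * (9 * N * l ^ τ + (2 * l + 1)) / l ^ 2 + 2)) ≤ K * (18 * N + 8) * l ^ (α - 2) := by
  have hl0 : 0 < l := by linarith
  have hlX : l ≤ l ^ (α - 2) := le_self_pow₀ hl (by omega)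
  have hτX : l ^ τ ≤ l * l ^ (α - 2) := by
    -- The exponents compare because `τ < α / 2 ≤ α - 1`.
    have e1 : l * l ^ (α - 2) = l ^ ((α - 1 : ℕ) : ℝ) := by
      rw [Real.rpow_natCast, ← pow_succ']
      congr 1; omega
    rw [e1]
    refine Real.rpow_le_rpow_of_exponent_le hl ?_
    rw [Nat.cast_sub (by omega)]
    push_cast
    linarith
  set X := l ^ (α - 2)
  calc l * (K * (2 * (9 * N * l ^ τ + (2 * l + 1)) / l ^ 2 + 2))
      ≤ l * (K * (2 * (9 * N * (l * X) + (2 * l + l)) / l ^ 2 + 2)) := by gcongr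
    _ = K * (18 * N * X + 6 + 2 * l) := by
        field_simp
        ring
    _ ≤ K * (18 * N * X + 6 * X + 2 * X) := by
        gcongr
        linarith
    _ = K * (18 * N + 8) * X := by ring

lemma pow_rpow_le_self {l β : ℝ} {α : ℕ} (hl : 1 ≤ l) (hα : 0 < α) (hβα : β < 7 / (8 * (α : ℝ))) :
    (l ^ α) ^ β ≤ l := by
  rw [← Real.rpow_natCast, ← Real.rpow_mul (by positivity)]
  have : (α : ℝ) * β ≤ 1 := by
    rw [lt_div_iff₀ (by positivity)] at hβα
    linarith
  exact (Real.rpow_le_rpow_of_exponent_le hl this).trans (Real.rpow_one _).le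

/-- A lower bound for the logarithm of the initial length scale. -/
def logThreshold (N d α : ℕ) (C C_geom M c_b : ℝ) : ℝ :=
  2 * (Real.log (C / C_geom) + 4 * (M * (4 + c_b)
    + 2 * (2 * Real.log C + N * d * (2 + α) + 2 + |Real.log C_geom|)))

set_option maxHeartbeats 800000 in
/-- The step of the scale induction from the length `l` to the length `l ^ α`. -/
lemma isNonsingular_of_not_isBad {E₁ C : ℝ} (hC : IsCutConstant N d E₁ C) (hC1 : 1 ≤ C)
    (hNd : 1 ≤ N * d) {τ β : ℝ} {α K : ℕ} (hτ : 1 < τ) (hα : 2 * τ < (α : ℝ))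
    (hβα : β < 7 / (8 * (α : ℝ))) {C_geom : ℝ} (hg : 0 < C_geom) {m M : ℝ} (hm : 0 ≤ m)
    (hM : m ≤ M) {W : Config N d → ℝ} (hW : ∃ B₀, IsBoundedPotential W B₀) {E : ℝ} (hE : E ≤ E₁)
    {l : ℕ} (hl : 4 ≤ l) (hlb : 2 * (2 + (K * (18 * N + 8) : ℝ)) ≤ l)
    (hlog : logThreshold N d α C C_geom M (K * (18 * N + 8)) ≤ Real.log l) {u : Lattice N d}
    (hgood : ¬ IsBad C_geom W τ K E m u l (l ^ α)) (hnr : IsNonresonant W E β u (l ^ α)) :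
    IsNonsingular C_geom W E m u (l ^ α) := by
  obtain ⟨B₀, hB₀⟩ := hW
  have hα3 : 3 ≤ α := by
    have : (2 : ℝ) < α := by linarith
    exact_mod_cast this
  set L : ℕ := l ^ α with hL
  set X : ℕ := l ^ (α - 2) with hX
  have hLX : L = l ^ 2 * X := by rw [hL, hX, ← pow_add]; congr 1; omega
  have hlX : l ≤ X := Nat.le_self_pow (by omega) l
  have hl' : (4 : ℝ) ≤ l := by exact_mod_cast hl
  have hlX' : (l : ℝ) ≤ X := by exact_mod_cast hlX
  have hLX' : (L : ℝ) = (l : ℝ) ^ 2 * X := by exact_mod_cast hLX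
  have hLα : (L : ℝ) = (l : ℝ) ^ α := by rw [hL]; push_cast; rfl
  obtain ⟨G, hG, hGn⟩ := exists_resolvent_of_isNonresonant hB₀ hnr
  set κ := Real.exp ((L : ℝ) ^ β) with hκ
  have hctrl : IsControlledResolvent E₁ C κ W E u L G := ⟨hC, hC1, ⟨B₀, hB₀⟩, hE, hG, hGn⟩
  have hκ1 : 1 ≤ κ := Real.one_le_exp (by positivity)
  -- Width `l ^ 2` allows about `l` steps per shell, so the surplus per shell is of order `g * l`
  -- against a loss of order `l` from `κ ^ 2` and the volume factor.
  obtain ⟨bad, hbad, hshell⟩ := exists_bad_shells hgood (D := l ^ 2) (by nlinarith) (X - 2)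
  -- The number of steps fitting in half a shell; the `-1` leaves room for the margins `2` on either
  -- side of the middle belt.
  set k := (l - 1) / 2 with hk
  have hC0 : 0 < C := by linarith
  have hs0 := stepFactor_nonneg (N := N) (d := d) hC0.le hg.le m l
  have hs1 := stepFactor_le_exp (N := N) (d := d) (m := m) hC0 hg (by omega : 1 ≤ l) hNd
  set g := Real.log l / 2 - Real.log (C / C_geom) with hgdef
  set c₂ := 2 * Real.log C + N * d * (2 + α) + 2 + |Real.log C_geom| with hc₂
  set c_b : ℝ := K * (18 * N + 8) with hcb
  have hlogC : 0 ≤ Real.log C := Real.log_nonneg hC1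
  have hcb0 : 0 ≤ c_b := by positivity
  have hc₂0 : 0 ≤ c₂ := by positivity
  have hM0 : 0 ≤ M := hm.trans hM
  have hg4 : 4 * (M * (4 + c_b) + 2 * c₂) ≤ g := by
    rw [logThreshold, ← hc₂] at hlog
    linarith
  have hg0 : 0 ≤ g := le_trans (by positivity) hg4
  set q := stepFactor N d C C_geom m l ^ (2 * k) with hq
  have hexp0 : 0 ≤ m * l + g := by positivity
  have hk2 : (l : ℝ) - 2 ≤ (2 * k : ℕ) := by
    have : l ≤ 2 * k + 2 := by omega
    have : (l : ℝ) ≤ (2 * k : ℕ) + 2 := by exact_mod_cast this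
    linarith
  have hqexp : q ≤ Real.exp (-((m * l + g) * (l - 2))) := by
    refine (pow_le_pow_left₀ hs0 hs1 _).trans ?_
    rw [← Real.exp_nat_mul, Real.exp_le_exp]
    have := mul_le_mul_of_nonneg_right hk2 hexp0
    linarith
  have hexp1 : 0 ≤ (m * l + g) * (l - 2) := mul_nonneg hexp0 (by linarith)
  have hq0 : 0 ≤ q := pow_nonneg hs0 _
  have hq1 : q ≤ 1 := hqexp.trans (Real.exp_le_one_iff.2 (by linarith))
  -- The shells end at radius `L - l ^ 2`, so every cube of radius `l` centred in one of them stays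
  -- inside the large cube.
  have hsize : (X - 2 + 1) * l ^ 2 + l ^ 2 = L := by
    obtain ⟨Y, hY⟩ : ∃ Y, X = Y + 2 := ⟨X - 2, by omega⟩
    rw [hLX, hY]; simp only [Nat.add_sub_cancel]; ring
  have hll : 4 * l ≤ l ^ 2 := by nlinarith
  have hkl : 2 * (k * l) + 4 ≤ l ^ 2 := by
    have h1 : 2 * k + 1 ≤ l := by omega
    nlinarith
  have hmain := hctrl.offDiag_boundary_le hκ1 (D := l ^ 2) (n := X - 2) (by nlinarith)
    (by omega) hq0 hq1 bad (fun j hj hjb => by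
      have hjL : (j + 2) * l ^ 2 + l ^ 2 ≤ L := by
        have : (j + 2) * l ^ 2 ≤ (X - 2 + 1) * l ^ 2 := Nat.mul_le_mul_right _ (by omega)
        omega
      have hja : (j + 2) * l ^ 2 = (j + 1) * l ^ 2 + l ^ 2 := by ring
      refine hctrl.offDiag_belt_le hg (by omega) (r := (j + 1) * l ^ 2 + 2 + k * l)
        (fun w h1 h2 => ?_) le_rfl (by omega) (by omega)
      have hsub : cube w l ⊆ cube u L := by
        refine cube_subset_cube ?_
        have : (((j + 2) * l ^ 2 : ℕ) : ℝ) + l ≤ L := by exact_mod_cast (by omega)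
        linarith
      push_cast at h1 h2
      exact ⟨hsub, hshell j hj hjb w hsub (by push_cast; linarith) (by push_cast; linarith)⟩)
  refine ⟨G, hG, ?_⟩
  change C_geom * (3 * (L : ℝ)) ^ (N * d)
    * offDiag G (belt u L) (cell u) (measurableSet_belt _ _) (measurableSet_cell u) ≤ _
  have hL1 : (1 : ℝ) ≤ L := by rw [hLα]; exact one_le_pow₀ (by linarith)
  -- The logarithm of the loss per shell; `a₁` is that of the prefactor in the definition of
  -- nonsingularity. The condition `α * β < 7/8` makes `L ^ β ≤ l`, hence both are `O(l)`.
  set a₀ := 2 * Real.log C + N * d * Real.log (2 * L + 1) + 2 * (L : ℝ) ^ β with ha₀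
  set a₁ := Real.log C_geom + N * d * Real.log (3 * L) with ha₁
  have hlog3 : Real.log (3 * L) ≤ (2 + α) * l := by
    rw [hLα]; exact log_three_mul_pow_le (by linarith) α
  have hlog2 : Real.log (2 * L + 1) ≤ (2 + α) * l :=
    (Real.log_le_log (by positivity) (by linarith)).trans hlog3
  have hlogpos : 0 ≤ Real.log (2 * L + 1) := Real.log_nonneg (by linarith)
  have hA : C ^ 2 * (2 * L + 1) ^ (N * d) * κ ^ 2 = Real.exp a₀ := by
    have e1 : Real.exp (N * d * Real.log (2 * L + 1)) = (2 * L + 1) ^ (N * d) := by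
      rw [← Nat.cast_mul, Real.exp_nat_mul, Real.exp_log (by positivity)]
    have e2 : Real.exp (2 * Real.log C) = C ^ 2 := by
      rw [show (2 : ℝ) = ((2 : ℕ) : ℝ) by norm_num, Real.exp_nat_mul, Real.exp_log hC0]
    have e3 : Real.exp (2 * (L : ℝ) ^ β) = κ ^ 2 := by
      rw [show (2 : ℝ) = ((2 : ℕ) : ℝ) by norm_num, Real.exp_nat_mul]
    rw [ha₀, Real.exp_add, Real.exp_add, e1, e2, e3]
  have hA1 : C_geom * (3 * (L : ℝ)) ^ (N * d) = Real.exp a₁ := by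
    rw [ha₁, Real.exp_add, Real.exp_log hg, ← Nat.cast_mul, Real.exp_nat_mul,
      Real.exp_log (by positivity)]
  have ha₀0 : 0 ≤ a₀ := by positivity
  have hLβ : (L : ℝ) ^ β ≤ l := by
    rw [hLα]; exact pow_rpow_le_self (by linarith) (by omega) hβα
  have hNd0 : (0 : ℝ) ≤ N * d := by positivity
  have ha₀le : a₀ ≤ c₂ * l := by
    have e1 := mul_le_mul_of_nonneg_left hlog2 hNd0
    have e2 : 2 * Real.log C ≤ 2 * Real.log C * l := le_mul_of_one_le_right (by positivity)
      (by linarith)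
    have e3 : 0 ≤ |Real.log C_geom| * l := by positivity
    rw [ha₀, hc₂]
    linarith
  have hlX0 : (l : ℝ) ≤ l * X := le_mul_of_one_le_right (by linarith) (by linarith)
  have ha₁le : a₁ ≤ c₂ * (l * X) := by
    have e1 := mul_le_mul_of_nonneg_left hlog3 hNd0
    have e2 : a₁ ≤ c₂ * l := by
      have e3 : |Real.log C_geom| ≤ |Real.log C_geom| * l :=
        le_mul_of_one_le_right (abs_nonneg _) (by linarith)
      have e4 := le_abs_self (Real.log C_geom)
      have e5 : 0 ≤ 2 * Real.log C * l := by positivity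
      rw [ha₁, hc₂]
      linarith
    exact e2.trans (mul_le_mul_of_nonneg_left hlX0 hc₂0)
  have hb : (l : ℝ) * bad.card ≤ c_b * X := by
    refine (mul_le_mul_of_nonneg_left hbad (by linarith)).trans ?_
    rw [hcb, hX]
    push_cast
    exact bad_shells_le N K (by linarith) hτ hα hα3
  have hqpow : q ^ (X - 2 - bad.card)
      ≤ Real.exp (-((m * l + g) * (l - 2) * (X - 2 - bad.card))) := by
    refine (pow_le_pow_left₀ hq0 hqexp _).trans ?_
    rw [← Real.exp_nat_mul, Real.exp_le_exp]
    -- Truncated subtraction can only enlarge the exponent, which is the favourable direction.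
    have e1 : (X : ℝ) - 2 - bad.card ≤ (X - 2 - bad.card : ℕ) := by
      have : X ≤ (X - 2 - bad.card) + 2 + bad.card := by omega
      have : (X : ℝ) ≤ (X - 2 - bad.card : ℕ) + 2 + bad.card := by exact_mod_cast this
      linarith
    have := mul_le_mul_of_nonneg_left e1 hexp1
    linarith
  have hApow : Real.exp a₀ ^ (X - 2 + 1) ≤ Real.exp (X * a₀) := by
    rw [← Real.exp_nat_mul, Real.exp_le_exp]
    refine mul_le_mul_of_nonneg_right ?_ ha₀0
    exact_mod_cast (by omega : X - 2 + 1 ≤ X)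
  rw [hA] at hmain
  rw [hA1]
  calc Real.exp a₁ * offDiag G (belt u L) (cell u) (measurableSet_belt _ _) (measurableSet_cell u)
      ≤ Real.exp a₁ * (Real.exp (X * a₀)
        * Real.exp (-((m * l + g) * (l - 2) * (X - 2 - bad.card)))) := by
        refine mul_le_mul_of_nonneg_left (hmain.trans ?_) (Real.exp_pos _).le
        exact mul_le_mul hApow hqpow (by positivity) (by positivity)
    _ = Real.exp (a₁ + X * a₀ - (m * l + g) * (l - 2) * (X - 2 - bad.card)) := by
        rw [← Real.exp_add, ← Real.exp_add]
        congr 1; ring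
    _ ≤ Real.exp (-(m * L)) := by
        rw [Real.exp_le_exp, hLX']
        exact exponent_estimate hl' hlX' (by positivity) hm hM hcb0 hb hlb ha₀le ha₁le hg4 hg0

end MultiParticle

end

/-- Every scale is at least `L₀`, and the thresholds of the step involve neither `k` nor `v`, `E` or
`m`, so one lower bound on `L₀` serves all of them. -/
theorem mainTheorem7 (N d : ℕ) (hN : 1 ≤ N) (hd : 1 ≤ d)
    (U : ℝ → ℝ) (ζ C_U : ℝ) (hU : MultiParticle.IsInteraction U ζ C_U)
    (φ : (Fin d → ℤ) → (Fin d → ℝ) → ℝ) (r₁ C_φ : ℝ) (hφ : MultiParticle.IsFlatTiling φ r₁ C_φ)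
    (c_V : ℝ) (hc_V : 0 < c_V)
    (τ β : ℝ) (α K : ℕ)
    (hτζ : ζ⁻¹ < τ) (hτ : 1 < τ) (hα : 2 * τ < (α : ℝ))
    (hβ : 0 < β) (hβ₁ : β < 1 / 4) (hβζ : β < ζ) (hβα : β < 7 / (8 * (α : ℝ)))
    (hK : 4 * α < K + 1)
    (C_geom : ℝ) (hC : 0 < C_geom) (Emax M : ℝ) :
    ∃ Lmin : ℕ, ∀ L₀ : ℕ, Lmin ≤ L₀ →
      ∀ m : ℝ, (L₀ : ℝ) ^ (-(1 / 2) : ℝ) ≤ m → m ≤ M →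
      ∀ v : (Fin d → ℤ) → ℝ, (∀ a, v a ∈ Set.Icc 0 c_V) →
      ∀ E : ℝ, E ≤ Emax →
      ∀ (k : ℕ) (u : MultiParticle.Lattice N d),
        ¬ MultiParticle.IsBad C_geom (MultiParticle.potential U φ v) τ K E m u
            (MultiParticle.scale L₀ α k) (MultiParticle.scale L₀ α (k + 1)) →
        MultiParticle.IsNonresonant (MultiParticle.potential U φ v) E β u
            (MultiParticle.scale L₀ α (k + 1)) →
        MultiParticle.IsNonsingular C_geom (MultiParticle.potential U φ v) E m u
            (MultiParticle.scale L₀ α (k + 1)) := by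
  obtain ⟨C, hC1, hcut⟩ := MultiParticle.exists_isCutConstant N d Emax
  obtain ⟨n₁, hn₁⟩ := exists_nat_ge (2 * (2 + (K * (18 * N + 8) : ℝ)))
  obtain ⟨n₂, hn₂⟩ := exists_nat_ge
    (Real.exp (MultiParticle.logThreshold N d α C C_geom M (K * (18 * N + 8))))
  refine ⟨max 4 (max n₁ n₂), fun L₀ hL₀ m hm hM v hv E hE k u hgood hnr => ?_⟩
  obtain ⟨h4, h12⟩ := max_le_iff.1 hL₀
  obtain ⟨h1, h2⟩ := max_le_iff.1 h12
  have hα0 : α ≠ 0 := by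
    rintro rfl
    norm_num at hα
    linarith
  have hscale : MultiParticle.scale L₀ α (k + 1) = MultiParticle.scale L₀ α k ^ α := by
    rw [MultiParticle.scale, MultiParticle.scale, ← pow_mul, pow_succ]
  have hle : L₀ ≤ MultiParticle.scale L₀ α k :=
    Nat.le_self_pow (pow_ne_zero _ hα0) L₀
  rw [hscale] at hgood hnr ⊢
  have hn₁' : (n₁ : ℝ) ≤ MultiParticle.scale L₀ α k := by exact_mod_cast h1.trans hle
  have hn₂' : (n₂ : ℝ) ≤ MultiParticle.scale L₀ α k := by exact_mod_cast h2.trans hle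
  -- From the lower bound on `m` the step needs only its sign; the upper bound `M` is what limits
  -- the loss caused by shells that give no decay.
  refine MultiParticle.isNonsingular_of_not_isBad hcut hC1 (Nat.mul_pos hN hd) hτ hα hβα hC
    (le_trans (by positivity) hm) hM (MultiParticle.isBoundedPotential_potential hU hφ hv) hE
    (h4.trans hle) (hn₁.trans hn₁') ?_ hgood hnr
  rw [Real.le_log_iff_exp_le (by exact_mod_cast (by omega : 0 < MultiParticle.scale L₀ α k))]
  exact hn₂.trans hn₂'
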